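/- An asymptotic couple is a pair $(\Gamma,\psi)$ of a (totally) ordered abelian group $\Gamma$ and a map $\psi:\Gamma^{\neq}\to\Gamma$, where $\Gamma^{\neq}:=\Gamma\setminus\{0\}$, such that for all $\alpha,\beta\in\Gamma^{\neq}$: (AC1) if $\alpha+\beta\neq 0$, then $\psi(\alpha+\beta)\geq\min(\psi(\alpha),\psi(\beta))$; (AC2) $\psi(r\alpha)=\psi(\alpha)$ for all $r\in\mathbb{Z}\setminus\{0\}$; (AC3) if $\alpha>0$, then $\alpha+\psi(\alpha)>\psi(\beta)$. It is of $H$-type if $0<\alpha\leq\beta$ implies $\psi(\alpha)\geq\psi(\beta)$. It has asymptotic integration if every $\alpha\in\Gamma$ has the form $\alpha=\beta+\psi(\beta)$ with $\beta\in\Gamma^{\neq}$; this $\beta$ is then unique and is denoted by $\int\alpha$, and one sets $s\alpha:=\psi(\int\alpha)$. Put $\Psi:=\psi(\Gamma^{\neq})$, ordered as a subset of $\Gamma$. A model of $T_{\log}$ is an asymptotic couple $(\Gamma,\psi)$ of $H$-type with asymptotic integration, with $\Gamma$ divisible, such that $\Psi$ has least element $s0>0$, each $\alpha\in\Psi$ has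 immediate successor $s\alpha$ in $\Psi$, and $\alpha\mapsto s\alpha$ is a bijection $\Psi\to\Psi^{>s0}:=\{\beta\in\Psi:\beta>s0\}$. It is viewed as a first-order structure with underlying set $\Gamma_\infty:=\Gamma\cup\{\infty\}$, where $\gamma<\infty$ for all $\gamma\in\Gamma$, in the language $L=\{0,+,-,<,\psi,\infty,s,p,\delta_1,\delta_2,\dots\}$: here $p$ is the inverse $\Psi^{>s0}\to\Psi$ of the bijection above, extended by $p(\alpha):=\infty$ for all other $\alpha\in\Gamma_\infty$; $\delta_n$ is division by $n$ on $\Gamma$; and $\infty$ is the default value, that is, $\psi(0)=\psi(\infty)=\infty$, $-\infty=s(\infty)=\delta_n(\infty)=\infty$, and $\gamma+\infty=\infty+\gamma=\infty$ for all $\gamma\in\Gamma_\infty$. **Corollary.** Let $(\Gamma,\psi)$ be a model of $T_{\log}$. Then the subset $\Psi$ is stably embedded in $(\Gamma,\psi)$: it is $\emptyset$-definable, and for every $n$, every subset of $\Psi^n$ that is definable in the $L$-structure $(\Gamma,\psi)$ with parameters from $\Gamma_\infty$ is definable in that structure with parameters from $\Psi$. Moreover, for every $n$, every subset of $\Psi^n$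 that is definable in $(\Gamma,\psi)$ with parameters from $\Gamma_\infty$ is definable in the structure $(\Psi;<)$ with parameters from $\Psi$. -/

import Mathlib

open FirstOrder

noncomputable section

namespace AsympCouple

section Couples

variable {Γ : Type*} [AddCommGroup Γ] [LinearOrder Γ] [IsOrderedAddMonoid Γ]

/-- `(Γ, ψ)` is an asymptotic couple. The map `ψ` is only meant on the nonzero elements of `Γ`:
the value `ψ 0` is arbitrary and plays no role (in the structure below, `0` is sent to `∞`). -/
structure IsAsymptoticCouple (ψ : Γ → Γ) : Prop where
  ac1 : ∀ α β : Γ, α ≠ 0 → β ≠ 0 → α + β ≠ 0 → min (ψ α) (ψ β) ≤ ψ (α + β)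
  ac2 : ∀ α : Γ, α ≠ 0 → ∀ r : ℤ, r ≠ 0 → ψ (r • α) = ψ α
  ac3 : ∀ α β : Γ, α ≠ 0 → β ≠ 0 → 0 < α → ψ β < α + ψ α

/-- An asymptotic couple of `H`-type. -/
structure IsHAsymptoticCouple (ψ : Γ → Γ) : Prop extends IsAsymptoticCouple ψ where
  hc : ∀ α β : Γ, 0 < α → α ≤ β → ψ β ≤ ψ α

/-- `Ψ = ψ(Γ^{≠})`. -/
def psiSet (ψ : Γ → Γ) : Set Γ := ψ '' {γ | γ ≠ 0}

/-- `Γ = (Γ^{≠})'`, where `γ' = γ + ψ γ`. -/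
def HasAsymptoticIntegration (ψ : Γ → Γ) : Prop :=
  ∀ α : Γ, ∃ β : Γ, β ≠ 0 ∧ β + ψ β = α

/-- `∫ α`: the element `β ≠ 0` with `β' = α` (unique by `eq_of_deriv_eq`). -/
def integral (ψ : Γ → Γ) (α : Γ) : Γ :=
  Classical.epsilon fun β : Γ => β ≠ 0 ∧ β + ψ β = α

/-- The successor function `s α = ψ (∫ α)`. -/
def succ (ψ : Γ → Γ) (α : Γ) : Γ := ψ (integral ψ α)

open Classical in
/-- The function `p` on `Γ`, with values in `Γ ∪ {∞}`: on `Ψ^{> s0}` it is the inverse of the map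
`s : Ψ → Ψ^{> s0}`, and elsewhere it takes the value `∞`. -/
def pred (ψ : Γ → Γ) (α : Γ) : WithTop Γ :=
  if α ∈ psiSet ψ ∧ succ ψ 0 < α then
    ((Function.invFunOn (succ ψ) (psiSet ψ) α : Γ) : WithTop Γ)
  else ⊤

/-- Division by `n ≥ 1` in a divisible torsion-free group: the `β` with `n β = α`. -/
def divBy (n : ℕ+) (α : Γ) : Γ := Classical.epsilon fun β : Γ => (n : ℕ) • β = α

/-- `(Γ, ψ)` is a model of `T_log`: a divisible `H`-asymptotic couple with asymptotic integration
such that `Ψ` has least element `s0 > 0`, each `α ∈ Ψ` has immediate successor `s α` in `Ψ`, and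
`s : Ψ → Ψ^{> s0}` is a bijection. -/
structure IsModelTlog (ψ : Γ → Γ) : Prop extends IsHAsymptoticCouple ψ where
  divisible : ∀ n : ℕ, 1 ≤ n → ∀ α : Γ, ∃ β : Γ, n • β = α
  integration : HasAsymptoticIntegration ψ
  least : IsLeast (psiSet ψ) (succ ψ 0)
  pos : 0 < succ ψ 0
  successor : ∀ α ∈ psiSet ψ, IsLeast {β | β ∈ psiSet ψ ∧ α < β} (succ ψ α)
  bij : Set.BijOn (succ ψ) (psiSet ψ) {β | β ∈ psiSet ψ ∧ succ ψ 0 < β}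

theorem eq_of_deriv_eq {ψ : Γ → Γ} (h : IsAsymptoticCouple ψ) {β γ : Γ} (hβ : β ≠ 0)
    (hγ : γ ≠ 0) (e : β + ψ β = γ + ψ γ) : β = γ := by
  have key : ∀ β γ : Γ, β ≠ 0 → γ ≠ 0 → β + ψ β = γ + ψ γ → ¬ γ < β := by
    intro β γ hβ hγ e hlt
    have hd : 0 < β - γ := sub_pos.2 hlt
    have h3 := h.ac3 (β - γ) γ hd.ne' hγ hd
    have eγ : ψ γ = (β - γ) + ψ β := by
      rw [sub_add_eq_add_sub, e]; abel
    have h4 : ψ β < ψ (β - γ) := by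
      rw [eγ] at h3; exact lt_of_add_lt_add_left h3
    have h5 : ψ β < ψ γ := by rw [eγ]; exact lt_add_of_pos_left _ hd
    have h6 := h.ac1 (β - γ) γ hd.ne' hγ (by simpa using hβ)
    rw [sub_add_cancel] at h6
    exact absurd h6 (not_le.2 (lt_min h4 h5))
  rcases lt_trichotomy β γ with h1 | h1 | h1
  · exact absurd h1 (key γ β hγ hβ e.symm)
  · exact h1
  · exact absurd h1 (key β γ hβ hγ e)

theorem integral_eq {ψ : Γ → Γ} (h : IsAsymptoticCouple ψ) {α β : Γ} (hβ : β ≠ 0)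
    (e : β + ψ β = α) : integral ψ α = β := by
  have hs := Classical.epsilon_spec (p := fun β : Γ => β ≠ 0 ∧ β + ψ β = α) ⟨β, hβ, e⟩
  exact eq_of_deriv_eq h hs.1 hβ (hs.2.trans e.symm)

end Couples

section Languages

/-- A single relation symbol, the binary symbol `<`. -/
inductive LtRel : ℕ → Type
  | lt : LtRel 2

/-- The language `{<}`. -/
def ltLang : Language := ⟨fun _ => Empty, LtRel⟩

instance ltStructure (X : Type*) [LT X] : ltLang.Structure X where
  funMap := fun f => nomatch f
  RelMap := fun r => match r with
    | .lt => fun x => x 0 < x 1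

/-- The function symbols `0, ∞, +, -, ψ, s, p, δ₁, δ₂, …`. -/
inductive TlogFunc : ℕ → Type
  | zero : TlogFunc 0
  | infty : TlogFunc 0
  | add : TlogFunc 2
  | neg : TlogFunc 1
  | psi : TlogFunc 1
  | s : TlogFunc 1
  | p : TlogFunc 1
  | delta (n : ℕ+) : TlogFunc 1

/-- The language `{0, +, -, <, ψ, ∞, s, p, δ₁, δ₂, …}` of `T_log`. -/
def tlogLang : Language := ⟨TlogFunc, LtRel⟩

variable {Γ : Type*} [AddCommGroup Γ] [LinearOrder Γ]

/-- The underlying set `Γ ∪ {∞}` of the structure `(Γ, ψ)`. -/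
def GammaInf (_ψ : Γ → Γ) : Type _ := WithTop Γ

/-- The inclusion of `Γ` into `Γ ∪ {∞}`. -/
def toInf (ψ : Γ → Γ) (γ : Γ) : GammaInf ψ := (γ : WithTop Γ)

open Classical in
/-- `(Γ, ψ)` as a structure with underlying set `Γ ∪ {∞}`, where `γ < ∞` for all `γ ∈ Γ`, and
with `∞` as default value. -/
instance tlogStructure (ψ : Γ → Γ) : tlogLang.Structure (GammaInf ψ) where
  funMap := fun f => match f with
    | .zero => fun _ => ((0 : Γ) : WithTop Γ)
    | .infty => fun _ => (⊤ : WithTop Γ)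
    | .add => fun (x : Fin 2 → WithTop Γ) => (x 0 + x 1 : WithTop Γ)
    | .neg => fun (x : Fin 1 → WithTop Γ) => WithTop.map (fun γ : Γ => -γ) (x 0)
    | .psi => fun (x : Fin 1 → WithTop Γ) =>
        WithTop.recTopCoe (C := fun _ => WithTop Γ) ⊤
          (fun γ : Γ => if γ = 0 then ⊤ else ((ψ γ : Γ) : WithTop Γ)) (x 0)
    | .s => fun (x : Fin 1 → WithTop Γ) => WithTop.map (succ ψ) (x 0)
    | .p => fun (x : Fin 1 → WithTop Γ) =>
        WithTop.recTopCoe (C := fun _ => WithTop Γ) ⊤ (pred ψ) (x 0)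
    | .delta n => fun (x : Fin 1 → WithTop Γ) => WithTop.map (divBy n) (x 0)
  RelMap := fun r => match r with
    | .lt => fun (x : Fin 2 → WithTop Γ) => x 0 < x 1

/-- `Ψ` as a subset of the structure `(Γ, ψ)`. -/
def psiInf (ψ : Γ → Γ) : Set (GammaInf ψ) := toInf ψ '' psiSet ψ

end Languages

/-- A subset `X` of a structure `M` is stably embedded: it is `∅`-definable, and every subset of a
power `X ^ n` that is definable in `M` with parameters is definable in `M` with parameters
from `X`. -/
def StablyEmbedded (L : Language) {M : Type*} [L.Structure M] (X : Set M) : Prop :=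
  (∅ : Set M).Definable₁ L X ∧
    ∀ (n : ℕ) (D : Set (Fin n → M)), (∀ x ∈ D, ∀ i, x i ∈ X) →
      (Set.univ : Set M).Definable L D → X.Definable L D

end AsympCouple

end

set_option linter.unusedSectionVars false

noncomputable section

namespace AsympCouple

universe u

/-! ### Algebra of one `H`-asymptotic couple: dominance and the successor identity -/

section Algebra

variable {Γ : Type*} [AddCommGroup Γ] [LinearOrder Γ] [IsOrderedAddMonoid Γ]

/-! The core is a back-and-forth theorem, `BackForth.elementary`: a partial isomorphism between
ℚ-subspaces of two models that respects order, `ψ`, `s`, `p` and `Ψ`, and whose trace on `Ψ` is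
partial elementary for the language `{<}` alone, preserves every formula of `tlogLang`. Thus `Γ`
puts nothing on `Ψ` beyond its order.

Why such maps extend rests on two facts about leading terms, where one element dominates another if
its `ψ`-value is smaller. For the first, let `c` be the least of finitely many elements of `Ψ`
outside the domain that occur with nonzero coefficient in a linear combination over the domain. By
the successor identity `ψ (d - c) = s c` for `c < d` in `Ψ`, the leading term is either an element
of the domain or a nonzero multiple of `s c - c`. Sign and `ψ`-value are therefore dictated by the
order on `Ψ`, so an elementary map on all of `Ψ` that is compatible with the given map can be
adjoined (`leading_cases`, `exists_isFull`). For the second, once the domain contains `Ψ`, finitely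
many conditions on the cut of a new element `b` and on the values `ψ (b - a)` are already satisfied
inside the domain (`exists_mem_of_finset`); an ultrapower realizes them simultaneously, and
adjoining `b` produces no new `ψ`-values (`IsFull.adjoin`, `IsFull.forth`). Compactness always takes
the form of an ultrapower, and the target model may be replaced by an elementary extension at each
step.

For the theorem itself, suppose `D` is not definable in `(Ψ; <)`. There are ultrafilters `U`, `V` on
`Ψ ^ n` that agree on all sets definable in `(Ψ; <)` with parameters but differ on `D`
(`exists_ultrafilter_pair`). The tuples of classes of the coordinate functions in the two
ultrapowers of `Γ` then satisfy the same `{<}`-formulas over `Ψ`. Hence the identity on the diagonal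
copies of `Γ` extends to a partial isomorphism matching these tuples, and no formula over `Γ` can
distinguish them. By Łoś a formula defining `D` would do so. This gives definability in `(Ψ; <)`;
relativizing quantifiers to `Ψ` turns such a definition into one in `(Γ, ψ)` with parameters from
`Ψ`. -/

theorem rat_smul_pos [Module ℚ Γ] {q : ℚ} (hq : 0 < q) {x : Γ} (hx : 0 < x) : 0 < q • x := by
  have h1 : (q.den : ℕ) • (q • x) = q.num.toNat • x := by
    rw [← Nat.cast_smul_eq_nsmul ℚ, ← Nat.cast_smul_eq_nsmul ℚ, smul_smul]
    congr 1
    rw [mul_comm, Rat.mul_den_eq_num]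
    have := Int.toNat_of_nonneg (Rat.num_pos.2 hq).le
    exact_mod_cast this.symm
  have h2 : 0 < q.num.toNat • x :=
    nsmul_pos hx (by have := Rat.num_pos.2 hq; omega)
  rw [← h1] at h2
  by_contra h
  exact absurd h2 (not_lt.2 (nsmul_nonpos (not_lt.1 h) _))

theorem rat_smul_pos_iff [Module ℚ Γ] {q : ℚ} (hq : 0 < q) {x : Γ} : 0 < q • x ↔ 0 < x := by
  refine ⟨fun h => ?_, rat_smul_pos hq⟩
  have := rat_smul_pos (inv_pos.2 hq) h
  rwa [smul_smul, inv_mul_cancel₀ hq.ne', one_smul] at this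

variable {ψ : Γ → Γ}

namespace IsAsymptoticCouple

theorem psi_neg (h : IsAsymptoticCouple ψ) {x : Γ} (hx : x ≠ 0) : ψ (-x) = ψ x := by
  simpa using h.ac2 x hx (-1) (by norm_num)

theorem psi_sub_comm (h : IsAsymptoticCouple ψ) {x y : Γ} (hx : x ≠ y) :
    ψ (x - y) = ψ (y - x) := by
  rw [← neg_sub, h.psi_neg (sub_ne_zero.2 hx.symm)]

theorem psi_smul [Module ℚ Γ] (h : IsAsymptoticCouple ψ) {q : ℚ} (hq : q ≠ 0) {x : Γ}
    (hx : x ≠ 0) : ψ (q • x) = ψ x := by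
  have h1 : (q.den : ℤ) • (q • x) = q.num • x := by
    rw [← Int.cast_smul_eq_zsmul ℚ, ← Int.cast_smul_eq_zsmul ℚ, smul_smul]
    congr 1
    rw [mul_comm]
    exact_mod_cast Rat.mul_den_eq_num q
  rw [← h.ac2 x hx q.num (by simpa using hq), ← h1,
    h.ac2 _ (smul_ne_zero hq hx) _ (by simp)]

/-- `s α` is the unique `c ≠ α` with `ψ (α - c) = c`. -/
theorem succ_eq (h : IsAsymptoticCouple ψ) {α c : Γ} (hc : α ≠ c) (e : ψ (α - c) = c) :
    succ ψ α = c := by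
  have : integral ψ α = α - c := integral_eq h (sub_ne_zero.2 hc) (by rw [e]; abel)
  rw [succ, this, e]

/-- The elements whose `ψ`-value exceeds `c`, together with `0`. -/
def small [Module ℚ Γ] (h : IsAsymptoticCouple ψ) (c : Γ) : Submodule ℚ Γ where
  carrier := {x | x ≠ 0 → c < ψ x}
  zero_mem' := fun h => absurd rfl h
  add_mem' := by
    intro x y hx hy hxy
    by_cases h0 : x = 0
    · subst h0; rw [zero_add] at hxy ⊢; exact hy hxy
    by_cases h1 : y = 0
    · subst h1; rw [add_zero] at hxy ⊢; exact hx hxy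
    exact lt_of_lt_of_le (lt_min (hx h0) (hy h1)) (h.ac1 x y h0 h1 hxy)
  smul_mem' := by
    intro q x hx hqx
    have h0 : x ≠ 0 := fun h0 => hqx (by rw [h0, smul_zero])
    have h1 : q ≠ 0 := fun h0 => hqx (by rw [h0, zero_smul])
    rw [h.psi_smul h1 h0]; exact hx h0

theorem mem_small_of_lt [Module ℚ Γ] (h : IsAsymptoticCouple ψ) {c x : Γ} (hx : c < ψ x) :
    x ∈ h.small c := fun _ => hx

theorem small_mono [Module ℚ Γ] (h : IsAsymptoticCouple ψ) {c d : Γ} (hcd : c ≤ d) :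
    h.small d ≤ h.small c := fun _ hx h0 => hcd.trans_lt (hx h0)

end IsAsymptoticCouple

section Dominance

variable [Module ℚ Γ]

/-- The ultrametric argument: if `ψ (e + d)` exceeded `ψ e`, then `e = (e + d) - d` would by AC1
have `ψ`-value above `ψ e`. This is what makes `e` the leading term of `e + d`. -/
theorem psi_add_small (h : IsAsymptoticCouple ψ) {e d : Γ} (he : e ≠ 0)
    (hd : d ∈ h.small (ψ e)) : e + d ≠ 0 ∧ ψ (e + d) = ψ e := by
  by_cases h0 : d = 0
  · subst h0; simp [he]
  have hd := hd h0
  have h1 : e + d ≠ 0 := by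
    intro h1
    rw [eq_neg_of_add_eq_zero_left h1, h.psi_neg h0] at hd
    exact lt_irrefl _ hd
  refine ⟨h1, le_antisymm ?_ ?_⟩
  · by_contra hlt
    push Not at hlt
    have := h.ac1 (e + d) (-d) h1 (neg_ne_zero.2 h0) (by simpa using he)
    rw [add_neg_cancel_right, h.psi_neg h0] at this
    exact absurd this (not_le.2 (lt_min hlt hd))
  · have := h.ac1 e d he h0 h1
    rwa [min_eq_left hd.le] at this

/-- This is where `H`-type enters: for `e > 0`, an inequality `e ≤ -d` would force `ψ d ≤ ψ e`. A
leading term therefore determines the sign as well. -/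
theorem pos_add_small (h : IsHAsymptoticCouple ψ) {e d : Γ} (he : e ≠ 0)
    (hd : d ∈ h.toIsAsymptoticCouple.small (ψ e)) : 0 < e + d ↔ 0 < e := by
  have key : ∀ {e d : Γ}, 0 < e → d ∈ h.toIsAsymptoticCouple.small (ψ e) → 0 < e + d := by
    intro e d he hd
    by_contra hn
    push Not at hn
    have hle : e ≤ -d := by rw [← sub_nonpos]; simpa using hn
    have h0 : d ≠ 0 := by rintro rfl; rw [neg_zero] at hle; exact absurd he (not_lt.2 hle)
    have := h.hc e (-d) he hle
    rw [h.psi_neg h0] at this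
    exact absurd (hd h0) (not_lt.2 this)
  refine ⟨fun h1 => ?_, fun h1 => key h1 hd⟩
  rcases lt_or_gt_of_ne he with h2 | h2
  · have := key (e := -e) (d := -d) (neg_pos.2 h2)
      (by rw [h.psi_neg he]; exact Submodule.neg_mem _ hd)
    rw [← neg_add, neg_pos] at this
    exact absurd h1 (not_lt.2 this.le)
  · exact h2

end Dominance

namespace IsModelTlog

variable (h : IsModelTlog ψ)

include h

theorem integral_spec (α : Γ) : integral ψ α ≠ 0 ∧ integral ψ α + ψ (integral ψ α) = α :=
  Classical.epsilon_spec (p := fun β : Γ => β ≠ 0 ∧ β + ψ β = α) (h.integration α)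

/-- The point is that `α - s α = ∫ α`. Together with `succ_eq` this characterizes `s` by `ψ` alone,
so that the choice made in `integral` never has to be unfolded again. -/
theorem succ_spec (α : Γ) : α ≠ succ ψ α ∧ ψ (α - succ ψ α) = succ ψ α := by
  obtain ⟨h1, h2⟩ := h.integral_spec α
  have h3 : α - succ ψ α = integral ψ α := by
    rw [succ, sub_eq_iff_eq_add]; exact h2.symm
  refine ⟨fun h4 => h1 ?_, by rw [h3]; rfl⟩
  rw [← h3, ← h4, sub_self]

theorem succ_mem (α : Γ) : succ ψ α ∈ psiSet ψ := ⟨_, (h.integral_spec α).1, rfl⟩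

theorem lt_succ {c : Γ} (hc : c ∈ psiSet ψ) : c < succ ψ c := (h.successor c hc).1.2

theorem succ_le {c d : Γ} (hc : c ∈ psiSet ψ) (hd : d ∈ psiSet ψ) (hcd : c < d) :
    succ ψ c ≤ d := (h.successor c hc).2 ⟨hd, hcd⟩

theorem succ_inj {c d : Γ} (hc : c ∈ psiSet ψ) (hd : d ∈ psiSet ψ) (e : succ ψ c = succ ψ d) :
    c = d := h.bij.injOn hc hd e

theorem succ_zero_le {c : Γ} (hc : c ∈ psiSet ψ) : succ ψ 0 ≤ c := h.least.2 hc

theorem exists_pred {c : Γ} (hc : c ∈ psiSet ψ) (h0 : c ≠ succ ψ 0) :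
    ∃ d ∈ psiSet ψ, succ ψ d = c :=
  h.bij.surjOn ⟨hc, lt_of_le_of_ne (h.succ_zero_le hc) h0.symm⟩

theorem succ_zero_lt_succ {c : Γ} (hc : c ∈ psiSet ψ) : succ ψ 0 < succ ψ c := (h.bij.mapsTo hc).2

theorem psi_mem {x : Γ} (hx : x ≠ 0) : ψ x ∈ psiSet ψ := ⟨x, hx, rfl⟩

/-- The successor identity on `Ψ`. -/
theorem psi_sub_of_lt {c d : Γ} (hc : c ∈ psiSet ψ) (hd : d ∈ psiSet ψ) (hcd : c < d) :
    ψ (d - c) = succ ψ c := by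
  have hdc : 0 < d - c := sub_pos.2 hcd
  -- Upper bound: `H`-type applied to `s c - c ≤ d - c`. Lower bound: AC3 gives `d < (d - c) + ψ (d
  -- - c)`, hence `c < ψ (d - c)`, and `s c` is the immediate successor of `c`.
  apply le_antisymm
  · have h1 := h.hc (succ ψ c - c) (d - c) (sub_pos.2 (h.lt_succ hc))
      (sub_le_sub_right (h.succ_le hc hd hcd) c)
    rwa [h.psi_sub_comm (h.succ_spec c).1.symm, (h.succ_spec c).2] at h1
  · obtain ⟨x, hx, rfl⟩ := hd
    have h1 := h.ac3 _ x hdc.ne' hx hdc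
    refine h.succ_le hc (h.psi_mem hdc.ne') ?_
    have h2 : ψ x - c + c < ψ x - c + ψ (ψ x - c) := by simpa using h1
    exact lt_of_add_lt_add_left h2

/-- The successor identity. -/
theorem psi_sub_of_succ_lt [Module ℚ Γ] {α β : Γ} (hlt : succ ψ α < succ ψ β) :
    β - α ≠ 0 ∧ ψ (β - α) = succ ψ α := by
  have h1 : ψ (succ ψ α - α) = succ ψ α := by
    rw [h.psi_sub_comm (h.succ_spec α).1.symm]; exact (h.succ_spec α).2
  -- Write `β - α = (s α - α) + (β - s β) + (s β - s α)`; the summands have `ψ`-values `s α`, `s β`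
  -- and `s (s α)`, so the first one dominates.
  have h2 : (β - succ ψ β) + (succ ψ β - succ ψ α) ∈ h.small (ψ (succ ψ α - α)) := by
    rw [h1]
    refine Submodule.add_mem _ ?_ ?_
    · apply h.mem_small_of_lt
      rw [(h.succ_spec β).2]; exact hlt
    · apply h.mem_small_of_lt
      rw [h.psi_sub_of_lt (h.succ_mem α) (h.succ_mem β) hlt]
      exact h.lt_succ (h.succ_mem α)
  have h3 := psi_add_small h.toIsAsymptoticCouple (sub_ne_zero.2 (h.succ_spec α).1.symm) h2
  have h4 : succ ψ α - α + (β - succ ψ β + (succ ψ β - succ ψ α)) = β - α := by abel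
  rw [h4, h1] at h3
  exact h3

/-- A positive element of `ψ`-value `c` in the span of `Ψ`. -/
theorem exists_pos_psi_eq_of_subset {A : AddSubgroup Γ} (hA : psiSet ψ ⊆ A) {c : Γ}
    (hc : c ∈ psiSet ψ) : ∃ e ∈ A, 0 < e ∧ ψ e = c := by
  -- The element `s 0` is its own `ψ`-value; every other `c` is some `s d`, and `s d - d` has
  -- `ψ`-value `s d`.
  by_cases h0 : c = succ ψ 0
  · subst h0
    refine ⟨succ ψ 0, hA hc, h.pos, ?_⟩
    have := (h.succ_spec 0).2
    rwa [zero_sub, h.psi_neg h.pos.ne'] at this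
  · obtain ⟨d, hd, rfl⟩ := h.exists_pred hc h0
    exact ⟨succ ψ d - d, A.sub_mem (hA hc) (hA hd), sub_pos.2 (h.lt_succ hd),
      h.psi_sub_of_lt hd hc (h.lt_succ hd)⟩

theorem pred_succ {c : Γ} (hc : c ∈ psiSet ψ) : pred ψ (succ ψ c) = ((c : Γ) : WithTop Γ) := by
  rw [pred, if_pos ⟨h.succ_mem c, h.succ_zero_lt_succ hc⟩, h.bij.injOn.leftInvOn_invFunOn hc]

theorem pred_eq_top {x : Γ} (hx : ¬ ∃ c ∈ psiSet ψ, succ ψ c = x) : pred ψ x = ⊤ := by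
  rw [pred, if_neg]
  rintro ⟨h1, h2⟩
  exact hx (h.exists_pred h1 h2.ne')

theorem divBy_eq [Module ℚ Γ] (n : ℕ+) (x : Γ) : divBy n x = ((n : ℚ)⁻¹) • x := by
  have hn : (n : ℚ) ≠ 0 := by exact_mod_cast n.ne_zero
  have h1 : (n : ℕ) • divBy n x = x :=
    Classical.epsilon_spec (p := fun β : Γ => (n : ℕ) • β = x) (h.divisible n n.pos x)
  rw [← Nat.cast_smul_eq_nsmul ℚ] at h1
  rw [← h1, smul_smul, inv_mul_cancel₀ hn, one_smul, h1]

end IsModelTlog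

end Algebra

/-! ### The symbols of the language on `Γ ∪ {∞}` -/

section GammaInf

variable {Γ : Type*} [AddCommGroup Γ] [LinearOrder Γ] {ψ : Γ → Γ}

instance (ψ : Γ → Γ) : LT (GammaInf ψ) := inferInstanceAs (LT (WithTop Γ))

/-- The element `∞`. -/
def topInf (ψ : Γ → Γ) : GammaInf ψ := (⊤ : WithTop Γ)

theorem eq_top_or_toInf (a : GammaInf ψ) : a = topInf ψ ∨ ∃ x, a = toInf ψ x := by
  induction a using WithTop.recTopCoe with
  | top => exact Or.inl rfl
  | coe x => exact Or.inr ⟨x, rfl⟩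

theorem toInf_ne_top (x : Γ) : toInf ψ x ≠ topInf ψ := WithTop.coe_ne_top

theorem toInf_inj {x y : Γ} : toInf ψ x = toInf ψ y ↔ x = y := WithTop.coe_inj

theorem toInf_lt_toInf {x y : Γ} : toInf ψ x < toInf ψ y ↔ x < y := WithTop.coe_lt_coe

theorem toInf_lt_top (x : Γ) : toInf ψ x < topInf ψ := WithTop.coe_lt_top x

theorem not_top_lt_inf (a : GammaInf ψ) : ¬ topInf ψ < a := not_top_lt (α := WithTop Γ)

open Classical in
/-- The values on `Γ` of the unary function symbols. -/
def unaryVal (ψ : Γ → Γ) : TlogFunc 1 → Γ → GammaInf ψ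
  | .neg, x => toInf ψ (-x)
  | .psi, x => if x = 0 then topInf ψ else toInf ψ (ψ x)
  | .s, x => toInf ψ (succ ψ x)
  | .p, x => pred ψ x
  | .delta n, x => toInf ψ (divBy n x)

theorem funMap_unary_top (f : TlogFunc 1) :
    (Language.Structure.funMap (L := tlogLang) f : (Fin 1 → GammaInf ψ) → _)
      (fun _ => topInf ψ) = topInf ψ := by
  cases f <;> rfl

theorem funMap_unary_toInf (f : TlogFunc 1) (x : Γ) :
    (Language.Structure.funMap (L := tlogLang) f : (Fin 1 → GammaInf ψ) → _)
      (fun _ => toInf ψ x) = unaryVal ψ f x := by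
  cases f <;> rfl

theorem funMap_add_toInf (x y : Γ) :
    (Language.Structure.funMap (L := tlogLang) TlogFunc.add : (Fin 2 → GammaInf ψ) → _)
      ![toInf ψ x, toInf ψ y] = toInf ψ (x + y) := rfl

theorem funMap_add_top_left (a : GammaInf ψ) :
    (Language.Structure.funMap (L := tlogLang) TlogFunc.add : (Fin 2 → GammaInf ψ) → _)
      ![topInf ψ, a] = topInf ψ := WithTop.top_add (α := Γ) a

theorem funMap_add_top_right (a : GammaInf ψ) :
    (Language.Structure.funMap (L := tlogLang) TlogFunc.add : (Fin 2 → GammaInf ψ) → _)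
      ![a, topInf ψ] = topInf ψ := WithTop.add_top (α := Γ) a

end GammaInf

/-! ### Ultrapowers of a model and Łoś's theorem -/

section Ultrapower

open Filter

variable {Γ : Type*} [AddCommGroup Γ] [LinearOrder Γ] [IsOrderedAddMonoid Γ] {ψ : Γ → Γ}
  {I : Type*} (U : Ultrafilter I)

/-- The map induced by `ψ` on the ultrapower of `Γ`. -/
def ultraPsi (ψ : Γ → Γ) : Germ (U : Filter I) Γ → Germ (U : Filter I) Γ := Germ.map ψ

variable {U}

theorem germ_eq_iff {x y : I → Γ} :
    (x : Germ (U : Filter I) Γ) = (y : Germ (U : Filter I) Γ) ↔ ∀ᶠ i in U, x i = y i :=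
  Germ.coe_eq

theorem germ_ne_zero {x : I → Γ} :
    (x : Germ (U : Filter I) Γ) ≠ 0 ↔ ∀ᶠ i in U, x i ≠ 0 := by
  rw [Ultrafilter.eventually_not, ← not_iff_not, not_not, not_not]
  exact germ_eq_iff (y := fun _ => (0 : Γ))

theorem isAsymptoticCouple_ultraPsi (h : IsAsymptoticCouple ψ) :
    IsAsymptoticCouple (ultraPsi U ψ) where
  ac1 := by
    intro α β
    refine Germ.inductionOn₂ α β fun x y hx hy hxy => ?_
    have hx := germ_ne_zero.1 hx
    have hy := germ_ne_zero.1 hy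
    have hxy := germ_ne_zero.1 hxy
    rw [Germ.min_def]
    refine Germ.coe_le.2 ?_
    filter_upwards [hx, hy, hxy] with i h1 h2 h3
    exact h.ac1 _ _ h1 h2 h3
  ac2 := by
    intro α
    refine Germ.inductionOn α fun x hx r hr => ?_
    have hx := germ_ne_zero.1 hx
    refine Germ.coe_eq.2 ?_
    filter_upwards [hx] with i h1
    exact h.ac2 _ h1 r hr
  ac3 := by
    intro α β
    refine Germ.inductionOn₂ α β fun x y hx hy hpos => ?_
    have hx := germ_ne_zero.1 hx
    have hy := germ_ne_zero.1 hy
    have hpos := Germ.coe_pos.1 hpos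
    refine Germ.coe_lt.2 ?_
    filter_upwards [hx, hy, hpos] with i h1 h2 h3
    exact h.ac3 _ _ h1 h2 h3

theorem mem_psiSet_germ {x : I → Γ} :
    (x : Germ (U : Filter I) Γ) ∈ psiSet (ultraPsi U ψ) ↔ ∀ᶠ i in U, x i ∈ psiSet ψ := by
  constructor
  · rintro ⟨y, hy, e⟩
    induction y using Germ.inductionOn with | _ y => ?_
    have hy := germ_ne_zero.1 hy
    have e := germ_eq_iff.1 e
    filter_upwards [hy, e] with i h1 h2
    exact ⟨_, h1, h2⟩
  · intro hx
    have : ∀ i, ∃ y, x i ∈ psiSet ψ → y ≠ 0 ∧ ψ y = x i := by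
      intro i
      by_cases hi : x i ∈ psiSet ψ
      · obtain ⟨y, hy⟩ := hi
        exact ⟨y, fun _ => hy⟩
      · exact ⟨0, fun h => absurd h hi⟩
    choose y hy using this
    refine ⟨(y : Germ (U : Filter I) Γ), germ_ne_zero.2 ?_, germ_eq_iff.2 ?_⟩
    · filter_upwards [hx] with i hi using (hy i hi).1
    · filter_upwards [hx] with i hi using (hy i hi).2

/-- `s` is defined through a choice of integral, which need not commute with taking germs; its
characterization in terms of `ψ` is checked pointwise instead. -/
theorem succ_germ (h : IsModelTlog ψ) (x : I → Γ) :
    succ (ultraPsi U ψ) (x : Germ (U : Filter I) Γ) =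
      ((fun i => succ ψ (x i) : I → Γ) : Germ (U : Filter I) Γ) := by
  refine (isAsymptoticCouple_ultraPsi h.toIsAsymptoticCouple).succ_eq ?_ ?_
  · intro e
    obtain ⟨i, hi⟩ := (germ_eq_iff.1 e).exists
    exact (h.succ_spec (x i)).1 hi
  · exact germ_eq_iff.2 (Eventually.of_forall fun i => (h.succ_spec (x i)).2)

theorem succ_germ_zero (h : IsModelTlog ψ) :
    succ (ultraPsi U ψ) 0 = ((fun _ => succ ψ 0 : I → Γ) : Germ (U : Filter I) Γ) :=
  succ_germ h fun _ => 0

theorem isModelTlog_ultraPsi (h : IsModelTlog ψ) : IsModelTlog (ultraPsi U ψ) where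
  toIsAsymptoticCouple := isAsymptoticCouple_ultraPsi h.toIsAsymptoticCouple
  hc := by
    intro α β
    refine Germ.inductionOn₂ α β fun x y hx hxy => ?_
    have hx := Germ.coe_pos.1 hx
    refine Germ.coe_le.2 ?_
    filter_upwards [hx, Germ.coe_le.1 hxy] with i h1 h2 using h.hc _ _ h1 h2
  divisible := by
    intro n hn α
    refine Germ.inductionOn α fun x => ?_
    choose y hy using fun i => h.divisible n hn (x i)
    exact ⟨(y : Germ (U : Filter I) Γ), germ_eq_iff.2 (Eventually.of_forall hy)⟩
  integration := by
    intro α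
    refine Germ.inductionOn α fun x => ?_
    choose y hy using fun i => h.integration (x i)
    exact ⟨(y : Germ (U : Filter I) Γ), germ_ne_zero.2 (Eventually.of_forall fun i => (hy i).1),
      germ_eq_iff.2 (Eventually.of_forall fun i => (hy i).2)⟩
  least := by
    rw [succ_germ_zero h]
    refine ⟨mem_psiSet_germ.2 (Eventually.of_forall fun _ => h.succ_mem 0), fun α => ?_⟩
    refine Germ.inductionOn α fun x hx => Germ.coe_le.2 ?_
    filter_upwards [mem_psiSet_germ.1 hx] with i hi using h.succ_zero_le hi
  pos := by
    rw [succ_germ_zero h]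
    exact Germ.coe_pos.2 (Eventually.of_forall fun _ => h.pos)
  successor := by
    intro α
    refine Germ.inductionOn α fun x hx => ?_
    have hx := mem_psiSet_germ.1 hx
    rw [succ_germ h]
    refine ⟨⟨mem_psiSet_germ.2 ?_, Germ.coe_lt.2 ?_⟩, fun β => ?_⟩
    · filter_upwards with i using h.succ_mem _
    · filter_upwards [hx] with i hi using h.lt_succ hi
    · refine Germ.inductionOn β fun y hy => Germ.coe_le.2 ?_
      filter_upwards [hx, mem_psiSet_germ.1 hy.1, Germ.coe_lt.1 hy.2] with i h1 h2 h3
      exact h.succ_le h1 h2 h3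
  bij := by
    refine ⟨fun α => ?_, fun α ha β => ?_, fun α => ?_⟩
    · refine Germ.inductionOn α fun x hx => ?_
      have hx := mem_psiSet_germ.1 hx
      rw [succ_germ_zero h, succ_germ h]
      refine ⟨mem_psiSet_germ.2 ?_, Germ.coe_lt.2 ?_⟩
      · filter_upwards with i using h.succ_mem _
      · filter_upwards [hx] with i hi using h.succ_zero_lt_succ hi
    · revert ha
      refine Germ.inductionOn₂ α β fun x y hx hy e => ?_
      rw [succ_germ h, succ_germ h] at e
      refine germ_eq_iff.2 ?_
      filter_upwards [mem_psiSet_germ.1 hx, mem_psiSet_germ.1 hy, germ_eq_iff.1 e] with i h1 h2 h3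
      exact h.succ_inj h1 h2 h3
    · refine Germ.inductionOn α fun x hx => ?_
      have h1 := mem_psiSet_germ.1 hx.1
      have h2 : ∀ᶠ i in U, succ ψ 0 < x i := by
        have := hx.2
        rw [succ_germ_zero h] at this
        exact Germ.coe_lt.1 this
      have : ∀ i, ∃ y, x i ∈ psiSet ψ → succ ψ 0 < x i → y ∈ psiSet ψ ∧ succ ψ y = x i := by
        intro i
        by_cases hi : x i ∈ psiSet ψ ∧ succ ψ 0 < x i
        · obtain ⟨y, hy⟩ := h.exists_pred hi.1 hi.2.ne'
          exact ⟨y, fun _ _ => hy⟩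
        · exact ⟨0, fun h1 h2 => absurd ⟨h1, h2⟩ hi⟩
      choose y hy using this
      refine ⟨(y : Germ (U : Filter I) Γ), mem_psiSet_germ.2 ?_, ?_⟩
      · filter_upwards [h1, h2] with i h1 h2 using (hy i h1 h2).1
      · rw [succ_germ h]
        refine germ_eq_iff.2 ?_
        filter_upwards [h1, h2] with i h1 h2 using (hy i h1 h2).2

variable (U) in
open Classical in
/-- The class of a family in `Γ ∪ {∞}` in the ultrapower of `Γ` together with `∞`. -/
def germInf (ψ : Γ → Γ) (f : I → GammaInf ψ) : GammaInf (ultraPsi U ψ) :=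
  if h : ∃ x : I → Γ, ∀ᶠ i in U, f i = toInf ψ (x i) then
    toInf (ultraPsi U ψ) (h.choose : Germ (U : Filter I) Γ)
  else topInf _

theorem germInf_of_toInf {f : I → GammaInf ψ} {x : I → Γ} (e : ∀ᶠ i in U, f i = toInf ψ (x i)) :
    germInf U ψ f = toInf (ultraPsi U ψ) (x : Germ (U : Filter I) Γ) := by
  have h : ∃ x : I → Γ, ∀ᶠ i in U, f i = toInf ψ (x i) := ⟨x, e⟩
  rw [germInf, dif_pos h, toInf_inj]
  refine germ_eq_iff.2 ?_
  filter_upwards [h.choose_spec, e] with i h1 h2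
  exact toInf_inj.1 (h1.symm.trans h2)

theorem germInf_of_top {f : I → GammaInf ψ} (e : ∀ᶠ i in U, f i = topInf ψ) :
    germInf U ψ f = topInf _ := by
  rw [germInf, dif_neg]
  rintro ⟨x, hx⟩
  obtain ⟨i, h1, h2⟩ := (e.and hx).exists
  exact toInf_ne_top _ (h2.symm.trans h1)

/-- The ultrafilter decides whether a family is mostly `∞` or mostly finite. This is why adding one
point `∞` to the ultrapower of `Γ` gives the ultrapower of `Γ ∪ {∞}`. -/
theorem eventually_top_or_toInf (U : Ultrafilter I) (f : I → GammaInf ψ) :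
    (∀ᶠ i in U, f i = topInf ψ) ∨ ∃ x : I → Γ, ∀ᶠ i in U, f i = toInf ψ (x i) := by
  by_cases hf : ∀ᶠ i in U, f i = topInf ψ
  · exact Or.inl hf
  · refine Or.inr ?_
    rw [← Ultrafilter.eventually_not] at hf
    have : ∀ i, ∃ x, f i ≠ topInf ψ → f i = toInf ψ x := fun i => by
      rcases eq_top_or_toInf (f i) with h | ⟨x, hx⟩
      · exact ⟨0, fun h' => absurd h h'⟩
      · exact ⟨x, fun _ => hx⟩
    choose x hx using this
    exact ⟨x, hf.mono fun i hi => hx i hi⟩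

theorem germInf_surjective (a : GammaInf (ultraPsi U ψ)) : ∃ f, a = germInf U ψ f := by
  rcases eq_top_or_toInf a with rfl | ⟨x, rfl⟩
  · exact ⟨fun _ => topInf ψ, (germInf_of_top (Eventually.of_forall fun _ => rfl)).symm⟩
  · induction x using Germ.inductionOn with | _ x => ?_
    exact ⟨fun i => toInf ψ (x i), (germInf_of_toInf (Eventually.of_forall fun _ => rfl)).symm⟩

theorem germInf_eq_iff {f g : I → GammaInf ψ} :
    germInf U ψ f = germInf U ψ g ↔ ∀ᶠ i in U, f i = g i := by
  rcases eventually_top_or_toInf U f with hf | ⟨x, hf⟩ <;>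
    rcases eventually_top_or_toInf U g with hg | ⟨y, hg⟩
  · rw [germInf_of_top hf, germInf_of_top hg]
    exact iff_of_true rfl ((hf.and hg).mono fun i hi => hi.1.trans hi.2.symm)
  · rw [germInf_of_top hf, germInf_of_toInf hg]
    refine iff_of_false (toInf_ne_top _).symm fun h => ?_
    obtain ⟨i, ⟨h1, h2⟩, h3⟩ := ((hf.and hg).and h).exists
    exact toInf_ne_top _ (h2.symm.trans (h3.symm.trans h1))
  · rw [germInf_of_toInf hf, germInf_of_top hg]
    refine iff_of_false (toInf_ne_top _) fun h => ?_
    obtain ⟨i, ⟨h1, h2⟩, h3⟩ := ((hf.and hg).and h).exists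
    exact toInf_ne_top _ (h1.symm.trans (h3.trans h2))
  · rw [germInf_of_toInf hf, germInf_of_toInf hg, toInf_inj, germ_eq_iff]
    exact eventually_congr ((hf.and hg).mono fun i hi => by rw [hi.1, hi.2, toInf_inj])

theorem germInf_lt_iff {f g : I → GammaInf ψ} :
    germInf U ψ f < germInf U ψ g ↔ ∀ᶠ i in U, f i < g i := by
  rcases eventually_top_or_toInf U f with hf | ⟨x, hf⟩
  · rw [germInf_of_top hf]
    refine iff_of_false (not_top_lt_inf _) fun h => ?_
    obtain ⟨i, h1, h3⟩ := (hf.and h).exists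
    rw [h1] at h3
    exact not_top_lt_inf _ h3
  rcases eventually_top_or_toInf U g with hg | ⟨y, hg⟩
  · rw [germInf_of_toInf hf, germInf_of_top hg]
    refine iff_of_true (toInf_lt_top _) ((hf.and hg).mono fun i hi => ?_)
    rw [hi.1, hi.2]
    exact toInf_lt_top _
  · rw [germInf_of_toInf hf, germInf_of_toInf hg, toInf_lt_toInf, Germ.coe_lt]
    exact eventually_congr ((hf.and hg).mono fun i hi => by rw [hi.1, hi.2, toInf_lt_toInf])

theorem unaryVal_germ [Module ℚ Γ] (h : IsModelTlog ψ) (f : TlogFunc 1) (x : I → Γ) :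
    unaryVal (ultraPsi U ψ) f (x : Germ (U : Filter I) Γ) =
      germInf U ψ fun i => unaryVal ψ f (x i) := by
  have h' : IsModelTlog (ultraPsi U ψ) := isModelTlog_ultraPsi h
  cases f with
  | neg => exact (germInf_of_toInf (Eventually.of_forall fun _ => rfl)).symm
  | psi =>
    by_cases h0 : (x : Germ (U : Filter I) Γ) = 0
    · rw [germInf_of_top, unaryVal, if_pos h0]
      have h0 : ∀ᶠ i in U, x i = 0 := germ_eq_iff.1 h0
      filter_upwards [h0] with i hi
      rw [unaryVal, if_pos hi]
    · rw [germInf_of_toInf (x := fun i => ψ (x i)), unaryVal, if_neg h0]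
      · rfl
      · filter_upwards [germ_ne_zero.1 h0] with i hi
        rw [unaryVal, if_neg hi]
  | s =>
    have e : ∀ᶠ i in U, unaryVal ψ .s (x i) = toInf ψ (succ ψ (x i)) :=
      Eventually.of_forall fun _ => rfl
    rw [germInf_of_toInf e, unaryVal, succ_germ h]
  | p =>
    by_cases h0 : ∀ᶠ i in U, ∃ c ∈ psiSet ψ, succ ψ c = x i
    · have : ∀ i, ∃ c, (∃ c ∈ psiSet ψ, succ ψ c = x i) → c ∈ psiSet ψ ∧ succ ψ c = x i := by
        intro i
        by_cases hi : ∃ c ∈ psiSet ψ, succ ψ c = x i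
        · exact hi.imp fun c hc _ => hc
        · exact ⟨0, fun h => absurd h hi⟩
      choose c hc using this
      have h1 : ((c : I → Γ) : Germ (U : Filter I) Γ) ∈ psiSet (ultraPsi U ψ) :=
        mem_psiSet_germ.2 (h0.mono fun i hi => (hc i hi).1)
      have h2 : (x : Germ (U : Filter I) Γ) = succ (ultraPsi U ψ) (c : Germ (U : Filter I) Γ) := by
        rw [succ_germ h]
        exact germ_eq_iff.2 (h0.mono fun i hi => (hc i hi).2.symm)
      rw [germInf_of_toInf (x := c), h2]
      · exact h'.pred_succ h1
      · filter_upwards [h0] with i hi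
        rw [← (hc i hi).2]
        exact h.pred_succ (hc i hi).1
    · rw [germInf_of_top]
      · refine h'.pred_eq_top ?_
        rintro ⟨c, hc, e⟩
        induction c using Germ.inductionOn with | _ c => ?_
        rw [succ_germ h] at e
        refine h0 ?_
        filter_upwards [mem_psiSet_germ.1 hc, germ_eq_iff.1 e] with i h1 h2 using ⟨_, h1, h2⟩
      · filter_upwards [Ultrafilter.eventually_not.2 h0] with i hi using h.pred_eq_top hi
  | delta n =>
    rw [germInf_of_toInf (x := fun i => ((n : ℚ)⁻¹) • x i), unaryVal, h'.divBy_eq]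
    · rfl
    · filter_upwards with i
      rw [unaryVal, h.divBy_eq]

theorem funMap_germInf [Module ℚ Γ] (h : IsModelTlog ψ) {n : ℕ} (f : TlogFunc n)
    (x : Fin n → I → GammaInf ψ) :
    Language.Structure.funMap (L := tlogLang) f (fun k => germInf U ψ (x k)) =
      germInf U ψ fun i => Language.Structure.funMap (L := tlogLang) f fun k => x k i := by
  have unary : ∀ (f : TlogFunc 1) (x : Fin 1 → I → GammaInf ψ),
      Language.Structure.funMap (L := tlogLang) f (fun k => germInf U ψ (x k)) =
        germInf U ψ fun i => Language.Structure.funMap (L := tlogLang) f fun k => x k i := by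
    intro f x
    have e1 : (fun k => germInf U ψ (x k)) = fun _ => germInf U ψ (x 0) :=
      funext fun k => by rw [Subsingleton.elim k 0]
    have e2 : ∀ i, (fun k => x k i) = fun _ => x 0 i :=
      fun i => funext fun k => by rw [Subsingleton.elim k 0]
    simp only [e1, e2]
    rcases eventually_top_or_toInf U (x 0) with hx | ⟨y, hx⟩
    · rw [germInf_of_top hx, funMap_unary_top, germInf_of_top]
      filter_upwards [hx] with i hi
      rw [hi, funMap_unary_top]
    · rw [germInf_of_toInf hx, funMap_unary_toInf, unaryVal_germ h, germInf_eq_iff]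
      filter_upwards [hx] with i hi
      rw [hi, funMap_unary_toInf]
  cases f with
  | zero => exact (germInf_of_toInf (x := fun _ => 0) (Eventually.of_forall fun _ => rfl)).symm
  | infty => exact (germInf_of_top (Eventually.of_forall fun _ => rfl)).symm
  | add =>
    have e1 : (fun k => germInf U ψ (x k)) = ![germInf U ψ (x 0), germInf U ψ (x 1)] :=
      funext fun k => by fin_cases k <;> rfl
    have e2 : ∀ i, (fun k => x k i) = ![x 0 i, x 1 i] :=
      fun i => funext fun k => by fin_cases k <;> rfl
    simp only [e1, e2]
    rcases eventually_top_or_toInf U (x 0) with hx | ⟨a, hx⟩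
    · rw [germInf_of_top hx, funMap_add_top_left, germInf_of_top]
      filter_upwards [hx] with i hi
      rw [hi, funMap_add_top_left]
    rcases eventually_top_or_toInf U (x 1) with hy | ⟨b, hy⟩
    · rw [germInf_of_top hy, funMap_add_top_right, germInf_of_top]
      filter_upwards [hy] with i hi
      rw [hi, funMap_add_top_right]
    · rw [germInf_of_toInf hx, germInf_of_toInf hy, funMap_add_toInf,
        germInf_of_toInf (x := fun i => a i + b i)]
      · rfl
      · filter_upwards [hx, hy] with i h1 h2
        rw [h1, h2, funMap_add_toInf]
  | neg => exact unary .neg x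
  | psi => exact unary .psi x
  | s => exact unary .s x
  | p => exact unary .p x
  | delta n => exact unary (.delta n) x

theorem realize_term_germInf [Module ℚ Γ] (h : IsModelTlog ψ) {α : Type*}
    (t : tlogLang.Term α) (v : α → I → GammaInf ψ) :
    t.realize (fun a => germInf U ψ (v a)) = germInf U ψ fun i => t.realize fun a => v a i := by
  induction t with
  | var => rfl
  | func f ts ih =>
    simp only [Language.Term.realize, ih]
    exact funMap_germInf h f _

/-- Łoś's theorem, with the ultrapower of `Γ ∪ {∞}` presented as the ultrapower of `Γ` with `∞`
added, so that the latter is again of the form `GammaInf` for a model of `T_log`. -/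
theorem realize_boundedFormula_germInf [Module ℚ Γ] (h : IsModelTlog ψ) {α : Type*} {n : ℕ}
    (φ : tlogLang.BoundedFormula α n) (v : α → I → GammaInf ψ) (xs : Fin n → I → GammaInf ψ) :
    φ.Realize (fun a => germInf U ψ (v a)) (fun k => germInf U ψ (xs k)) ↔
      ∀ᶠ i in U, φ.Realize (fun a => v a i) fun k => xs k i := by
  have elim : ∀ {n : ℕ} (xs : Fin n → I → GammaInf ψ),
      Sum.elim (fun a => germInf U ψ (v a)) (fun k => germInf U ψ (xs k)) =
        fun a => germInf U ψ (Sum.elim v xs a) := fun xs => funext fun a => by cases a <;> rfl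
  have elim' : ∀ {n : ℕ} (xs : Fin n → I → GammaInf ψ) (i : I),
      Sum.elim (fun a => v a i) (fun k => xs k i) = fun a => Sum.elim v xs a i :=
    fun xs i => funext fun a => by cases a <;> rfl
  induction φ with
  | falsum => simp [Language.BoundedFormula.Realize, U.neBot.ne]
  | equal t u =>
    simp only [Language.BoundedFormula.Realize, elim, elim', realize_term_germInf h,
      germInf_eq_iff]
  | rel R ts =>
    cases R
    simp only [Language.BoundedFormula.Realize, elim, elim', realize_term_germInf h]
    exact germInf_lt_iff
  | imp φ θ ih1 ih2 =>
    simp only [Language.BoundedFormula.Realize, ih1, ih2, Ultrafilter.eventually_imp]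
  | all φ ih =>
    have snoc : ∀ f : I → GammaInf ψ, (Fin.snoc (fun k => germInf U ψ (xs k)) (germInf U ψ f) :
        Fin _ → GammaInf (ultraPsi U ψ)) =
        fun k => germInf U ψ ((Fin.snoc xs f : Fin _ → I → GammaInf ψ) k) := by
      intro f
      funext k
      refine Fin.lastCases ?_ (fun k => ?_) k <;> simp
    have snoc' : ∀ (f : I → GammaInf ψ) (i : I),
        (fun k => (Fin.snoc xs f : Fin _ → I → GammaInf ψ) k i) =
          (Fin.snoc (fun k => xs k i) (f i) : Fin _ → GammaInf ψ) := by
      intro f i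
      funext k
      refine Fin.lastCases ?_ (fun k => ?_) k <;> simp
    simp only [Language.BoundedFormula.Realize]
    constructor
    · intro H
      by_contra hn
      rw [← Ultrafilter.eventually_not] at hn
      have : ∀ i, ∃ a : GammaInf ψ,
          (¬ ∀ a, φ.Realize (fun a => v a i) (Fin.snoc (fun k => xs k i) a)) →
            ¬ φ.Realize (fun a => v a i) (Fin.snoc (fun k => xs k i) a) := by
        intro i
        by_cases hi : ∀ a, φ.Realize (fun a => v a i) (Fin.snoc (fun k => xs k i) a)
        · exact ⟨topInf ψ, fun h => absurd hi h⟩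
        · push Not at hi
          exact hi.imp fun a ha _ => ha
      choose f hf using this
      have h1 := H (germInf U ψ f)
      rw [snoc] at h1
      replace h1 := (ih _).1 h1
      obtain ⟨i, h2, h3⟩ := (h1.and hn).exists
      rw [snoc'] at h2
      exact hf i h3 h2
    · intro H a
      obtain ⟨f, rfl⟩ := germInf_surjective a
      rw [snoc]
      refine (ih _).2 ?_
      filter_upwards [H] with i hi
      rw [snoc']
      exact hi _

end Ultrapower

theorem realize_boundedFormula_zero {L : Language} {M α : Type*} [L.Structure M]
    (φ : L.Formula α) (v : α → M) (xs : Fin 0 → M) :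
    Language.BoundedFormula.Realize φ v xs ↔ φ.Realize v := by
  rw [Language.Formula.Realize, Subsingleton.elim xs default]

/-! ### Formulas about `(Ψ; <)` read inside `(Γ, ψ)` -/

section Relativization

/-- The inclusion of the language `{<}` into the language of `T_log`. -/
def ltToTlog : ltLang →ᴸ tlogLang where
  onFunction := fun {_} f => nomatch f
  onRelation := fun {_} r => r

/-- The quantifier-free formula `x ∈ Ψ`: `p (s x) = x` and `x ≠ ∞`. -/
def isPsi {α : Type*} {n : ℕ} (t : tlogLang.Term (α ⊕ Fin n)) : tlogLang.BoundedFormula α n :=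
  Language.BoundedFormula.equal
      (Language.Term.func (L := tlogLang) (TlogFunc.p : TlogFunc 1) fun _ =>
        Language.Term.func (L := tlogLang) (TlogFunc.s : TlogFunc 1) fun _ => t) t ⊓
    ∼(Language.BoundedFormula.equal t
      (Language.Term.func (L := tlogLang) (TlogFunc.infty : TlogFunc 0) nofun))

/-- Relativization of a formula in the language `{<}` to `Ψ`. -/
def relForm {α : Type*} : ∀ {n : ℕ}, ltLang.BoundedFormula α n → tlogLang.BoundedFormula α n
  | _, .falsum => .falsum
  | _, .equal t u => .equal (ltToTlog.onTerm t) (ltToTlog.onTerm u)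
  | _, .rel (l := l) R ts => .rel (show tlogLang.Relations l from R) fun i => ltToTlog.onTerm (ts i)
  | _, .imp φ θ => .imp (relForm φ) (relForm θ)
  | n, .all φ => .all (.imp (isPsi (.var (Sum.inr (Fin.last n)))) (relForm φ))

variable {Γ : Type*} [AddCommGroup Γ] [LinearOrder Γ] [IsOrderedAddMonoid Γ] {ψ : Γ → Γ}

/-- If `p (s x) = x ≠ ∞`, then `s x = s c` for some `c ∈ Ψ`, whence `x = p (s c) = c`. The clause `x
≠ ∞` is needed because `p (s ∞) = ∞`. -/
theorem realize_isPsi (h : IsModelTlog ψ) {α : Type*} {n : ℕ} (t : tlogLang.Term (α ⊕ Fin n))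
    (v : α → GammaInf ψ) (xs : Fin n → GammaInf ψ) :
    (isPsi t).Realize v xs ↔ t.realize (Sum.elim v xs) ∈ psiInf ψ := by
  have key : (isPsi t).Realize v xs ↔
      (Language.Structure.funMap (L := tlogLang) (TlogFunc.p : TlogFunc 1) (fun _ =>
        Language.Structure.funMap (L := tlogLang) (TlogFunc.s : TlogFunc 1) fun _ =>
          t.realize (Sum.elim v xs)) = t.realize (Sum.elim v xs) ∧
        ¬ t.realize (Sum.elim v xs) = topInf ψ) := by
    rw [isPsi, Language.BoundedFormula.realize_inf, Language.BoundedFormula.realize_not]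
    rfl
  rw [key]
  generalize t.realize (Sum.elim v xs) = a
  rcases eq_top_or_toInf a with rfl | ⟨x, rfl⟩
  · refine iff_of_false (fun h => h.2 rfl) ?_
    rintro ⟨y, -, e⟩
    exact toInf_ne_top _ e
  · rw [funMap_unary_toInf]
    have : (fun _ => unaryVal ψ .s x : Fin 1 → GammaInf ψ) = fun _ => toInf ψ (succ ψ x) := rfl
    rw [this, funMap_unary_toInf]
    constructor
    · rintro ⟨e, -⟩
      by_cases hx : ∃ c ∈ psiSet ψ, succ ψ c = succ ψ x
      · obtain ⟨c, hc, hcx⟩ := hx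
        have e : pred ψ (succ ψ x) = ((x : Γ) : WithTop Γ) := e
        rw [← hcx, h.pred_succ hc, WithTop.coe_inj] at e
        exact ⟨x, e ▸ hc, rfl⟩
      · exact absurd (e.symm.trans (h.pred_eq_top hx)) (toInf_ne_top x)
    · rintro ⟨y, hy, e⟩
      rw [← toInf_inj.1 e]
      exact ⟨h.pred_succ hy, toInf_ne_top _⟩

theorem realize_ltToTlog {α : Type*} (t : ltLang.Term α) (v : α → psiSet ψ) :
    (ltToTlog.onTerm t).realize (fun a => toInf ψ (v a)) = toInf ψ (t.realize v : psiSet ψ) := by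
  cases t with
  | var => rfl
  | func f => exact nomatch f

theorem realize_relForm (h : IsModelTlog ψ) {α : Type*} {n : ℕ} (φ : ltLang.BoundedFormula α n)
    (v : α → psiSet ψ) (xs : Fin n → psiSet ψ) :
    (relForm φ).Realize (fun a => toInf ψ (v a)) (fun k => toInf ψ (xs k)) ↔ φ.Realize v xs := by
  have elim : ∀ {n : ℕ} (xs : Fin n → psiSet ψ),
      Sum.elim (fun a => toInf ψ (v a)) (fun k => toInf ψ (xs k)) =
        fun a => toInf ψ (Sum.elim v xs a : psiSet ψ) :=
    fun xs => funext fun a => by cases a <;> rfl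
  induction φ with
  | falsum => rfl
  | equal t u =>
    simp only [relForm, Language.BoundedFormula.Realize, elim, realize_ltToTlog, toInf_inj,
      Subtype.coe_inj]
  | rel R ts =>
    cases R
    simp only [relForm, Language.BoundedFormula.Realize, elim, realize_ltToTlog]
    exact toInf_lt_toInf
  | imp φ θ ih1 ih2 => simp only [relForm, Language.BoundedFormula.Realize, ih1, ih2]
  | all φ ih =>
    have snoc : ∀ c : psiSet ψ, (Fin.snoc (fun k => toInf ψ (xs k)) (toInf ψ c) :
        Fin _ → GammaInf ψ) = fun k => toInf ψ ((Fin.snoc xs c : Fin _ → psiSet ψ) k) := by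
      intro f
      funext k
      refine Fin.lastCases ?_ (fun k => ?_) k <;> simp
    simp only [relForm, Language.BoundedFormula.Realize, realize_isPsi h,
      Language.Term.realize_var, Sum.elim_inr, Fin.snoc_last]
    constructor
    · intro H c
      have h1 := H (toInf ψ c) ⟨c, c.2, rfl⟩
      rw [snoc] at h1
      exact (ih _).1 h1
    · rintro H _ ⟨c, hc, rfl⟩
      rw [snoc ⟨c, hc⟩]
      exact (ih _).2 (H ⟨c, hc⟩)

theorem realize_formula_relForm (h : IsModelTlog ψ) {α : Type*} (φ : ltLang.Formula α)
    (v : α → psiSet ψ) :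
    Language.Formula.Realize (relForm φ) (fun a => toInf ψ (v a)) ↔ φ.Realize v := by
  rw [Language.Formula.Realize, Language.Formula.Realize, ← realize_relForm h]
  exact (realize_boundedFormula_zero (relForm φ) _ _).symm

end Relativization

section LtFormulas

variable {X : Type*} [LT X] {α : Type*}

/-- The relation symbol `<`. -/
def ltSymb : ltLang.Relations 2 := LtRel.lt

/-- The formula `x < y`. -/
def ltForm (a b : α) : ltLang.Formula α :=
  Language.Relations.formula₂ (L := ltLang) ltSymb (.var a) (.var b)

theorem realize_ltForm {a b : α} {v : α → X} : (ltForm a b).Realize v ↔ v a < v b := by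
  rw [ltForm, Language.Formula.realize_rel₂]
  rfl

/-- The formula expressing that there is nothing strictly between `x` and `y`. -/
def noneBetween (a b : α) : ltLang.Formula α :=
  ∀' ((Language.Relations.boundedFormula₂ (L := ltLang) ltSymb
      (.var (Sum.inl a)) (.var (Sum.inr 0))).imp
    ∼(Language.Relations.boundedFormula₂ (L := ltLang) ltSymb
      (.var (Sum.inr 0)) (.var (Sum.inl b))))

theorem realize_noneBetween {a b : α} {v : α → X} :
    (noneBetween a b).Realize v ↔ ∀ z, v a < z → ¬ z < v b := by
  simp only [noneBetween, Language.Formula.Realize, Language.BoundedFormula.realize_all,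
    Language.BoundedFormula.realize_imp, Language.BoundedFormula.realize_not,
    Language.BoundedFormula.realize_rel₂]
  rfl

end LtFormulas

/-- A model of `T_log`, bundled with its structure of ordered vector space over `ℚ`. -/
structure TlogModel : Type (u + 1) where
  carrier : Type u
  [addCommGroup : AddCommGroup carrier]
  [linearOrder : LinearOrder carrier]
  [isOrderedAddMonoid : IsOrderedAddMonoid carrier]
  [module : Module ℚ carrier]
  ψ : carrier → carrier
  isModel : IsModelTlog ψ

/-! ### Elementary embeddings of models -/

namespace TlogModel

instance : CoeSort TlogModel.{u} (Type u) := ⟨TlogModel.carrier⟩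

instance (M : TlogModel.{u}) : AddCommGroup M := M.addCommGroup
instance (M : TlogModel.{u}) : LinearOrder M := M.linearOrder
instance (M : TlogModel.{u}) : IsOrderedAddMonoid M := M.isOrderedAddMonoid
instance (M : TlogModel.{u}) : Module ℚ M := M.module

/-- The set `Ψ` of a model. -/
abbrev Psi (M : TlogModel.{u}) : Set M := psiSet M.ψ

/-- The ultrapower of a model. -/
def ultra (N : TlogModel.{u}) {I : Type u} (U : Ultrafilter I) : TlogModel.{u} where
  carrier := Filter.Germ (U : Filter I) N
  ψ := ultraPsi U N.ψ
  isModel := isModelTlog_ultraPsi N.isModel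

variable {M N N' : TlogModel.{u}}

/-- The extension of a relation between `Γ_M` and `Γ_N` by `∞ ~ ∞`. -/
def InfRel (R : Submodule ℚ (M × N)) (a : GammaInf M.ψ) (b : GammaInf N.ψ) : Prop :=
  (a = topInf _ ∧ b = topInf _) ∨ ∃ x y, (x, y) ∈ R ∧ a = toInf _ x ∧ b = toInf _ y

/-- The relation preserves all formulas. -/
def Elementary (R : Submodule ℚ (M × N)) : Prop :=
  ∀ {α : Type u} {n : ℕ} (φ : tlogLang.BoundedFormula α n) (v : α → GammaInf M.ψ)
    (w : α → GammaInf N.ψ) (xs : Fin n → GammaInf M.ψ) (ys : Fin n → GammaInf N.ψ),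
    (∀ a, InfRel R (v a) (w a)) → (∀ k, InfRel R (xs k) (ys k)) →
      (φ.Realize v xs ↔ φ.Realize w ys)

theorem Elementary.realize_formula {R : Submodule ℚ (M × N)} (hR : Elementary R) {α : Type u}
    (φ : tlogLang.Formula α) {v : α → GammaInf M.ψ} {w : α → GammaInf N.ψ}
    (hvw : ∀ a, InfRel R (v a) (w a)) : φ.Realize v ↔ φ.Realize w :=
  hR φ v w default default hvw fun k => k.elim0

theorem Elementary.realize_ltFormula {R : Submodule ℚ (M × N)} (hR : Elementary R) {α : Type u}
    (φ : ltLang.Formula α) {v : α → M.Psi} {w : α → N.Psi}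
    (hvw : ∀ a, ((v a : M), (w a : N)) ∈ R) : φ.Realize v ↔ φ.Realize w := by
  rw [← realize_formula_relForm M.isModel, ← realize_formula_relForm N.isModel]
  exact hR.realize_formula _ fun a => Or.inr ⟨_, _, hvw a, rfl, rfl⟩

/-- A linear map between models that is an elementary embedding. -/
structure IsElem (j : N →ₗ[ℚ] N') : Prop where
  pos : ∀ x, 0 < j x ↔ 0 < x
  psi : ∀ x, x ≠ 0 → N'.ψ (j x) = j (N.ψ x)
  elem : Elementary j.graph

theorem InfRel.comp_graph {N'' : TlogModel.{u}} {j : N →ₗ[ℚ] N'} {k : N' →ₗ[ℚ] N''}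
    {a : GammaInf N.ψ} {c : GammaInf N''.ψ} (h : InfRel (k ∘ₗ j).graph a c) :
    ∃ b, InfRel j.graph a b ∧ InfRel k.graph b c := by
  rcases h with ⟨rfl, rfl⟩ | ⟨x, y, hxy, rfl, rfl⟩
  · exact ⟨topInf _, Or.inl ⟨rfl, rfl⟩, Or.inl ⟨rfl, rfl⟩⟩
  · have e : y = k (j x) := LinearMap.mem_graph_iff _ _ |>.1 hxy
    subst e
    exact ⟨toInf _ (j x), Or.inr ⟨_, _, (LinearMap.mem_graph_iff _ _).2 rfl, rfl, rfl⟩,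
      Or.inr ⟨_, _, (LinearMap.mem_graph_iff _ _).2 rfl, rfl, rfl⟩⟩

namespace IsElem

theorem ne_zero {j : N →ₗ[ℚ] N'} (hj : IsElem j) {x : N} (hx : x ≠ 0) : j x ≠ 0 := by
  intro h0
  rcases lt_or_gt_of_ne hx with h | h
  · have h1 := (hj.pos (-x)).2 (neg_pos.2 h)
    rw [map_neg, h0, neg_zero] at h1
    exact lt_irrefl _ h1
  · have h1 := (hj.pos x).2 h
    rw [h0] at h1
    exact lt_irrefl _ h1

theorem injective {j : N →ₗ[ℚ] N'} (hj : IsElem j) : Function.Injective j :=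
  (injective_iff_map_eq_zero j).2 fun _ hx => by_contra fun h0 => hj.ne_zero h0 hx

theorem succ {j : N →ₗ[ℚ] N'} (hj : IsElem j) (x : N) :
    AsympCouple.succ N'.ψ (j x) = j (AsympCouple.succ N.ψ x) := by
  obtain ⟨h1, h2⟩ := N.isModel.succ_spec x
  refine N'.isModel.succ_eq (fun e => h1 (hj.injective e)) ?_
  rw [← map_sub, hj.psi _ (sub_ne_zero.2 h1), h2]

/-- Membership in `Ψ` is reflected with the help of `s`: if `j x ∈ Ψ`, then `s (j x) > s 0`, so `s
x` is not `s 0` and equals `s c` for some `c ∈ Ψ`. Injectivity of `s` on `Ψ` gives `j c = j x`. -/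
theorem mem {j : N →ₗ[ℚ] N'} (hj : IsElem j) (x : N) : j x ∈ N'.Psi ↔ x ∈ N.Psi := by
  constructor
  · intro hx
    by_cases h0 : AsympCouple.succ N.ψ x = AsympCouple.succ N.ψ 0
    · have h1 := N'.isModel.succ_zero_lt_succ hx
      rw [hj.succ, h0, ← hj.succ, map_zero] at h1
      exact absurd h1 (lt_irrefl _)
    · obtain ⟨c, ⟨y, hy, rfl⟩, e⟩ := N.isModel.exists_pred (N.isModel.succ_mem x) h0
      have h1 : j (N.ψ y) ∈ N'.Psi := ⟨j y, hj.ne_zero hy, hj.psi y hy⟩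
      have h2 : j (N.ψ y) = j x := by
        refine N'.isModel.succ_inj h1 hx ?_
        rw [hj.succ, hj.succ, e]
      rw [← hj.injective h2]
      exact N.isModel.psi_mem hy
  · rintro ⟨y, hy, rfl⟩
    exact ⟨j y, hj.ne_zero hy, hj.psi y hy⟩

theorem comp {N'' : TlogModel.{u}} {j : N →ₗ[ℚ] N'} {k : N' →ₗ[ℚ] N''} (hk : IsElem k)
    (hj : IsElem j) : IsElem (k ∘ₗ j) where
  pos x := (hk.pos _).trans (hj.pos _)
  psi x hx := by
    rw [LinearMap.comp_apply, hk.psi _ (hj.ne_zero hx), hj.psi _ hx, LinearMap.comp_apply]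
  elem := by
    intro α n φ v w xs ys hvw hxy
    choose v' h1 h2 using fun a => (hvw a).comp_graph
    choose xs' h3 h4 using fun a => (hxy a).comp_graph
    exact (hj.elem φ v v' xs xs' h1 h3).trans (hk.elem φ v' w xs' ys h2 h4)

end IsElem

section Const

variable {I : Type u} (U : Ultrafilter I)

/-- The diagonal embedding of a model into its ultrapower. -/
def const (N : TlogModel.{u}) (U : Ultrafilter I) : N →ₗ[ℚ] N.ultra U where
  toFun x := ((fun _ => x : I → N) : Filter.Germ (U : Filter I) N)
  map_add' _ _ := rfl
  map_smul' _ _ := rfl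

theorem InfRel.eq_germInf {a : GammaInf N.ψ} {b : GammaInf (N.ultra U).ψ}
    (h : InfRel (const N U).graph a b) : b = germInf U N.ψ fun _ => a := by
  rcases h with ⟨rfl, rfl⟩ | ⟨x, y, hxy, rfl, rfl⟩
  · exact (germInf_of_top (Filter.Eventually.of_forall fun _ => rfl)).symm
  · have e : y = const N U x := LinearMap.mem_graph_iff _ _ |>.1 hxy
    subst e
    exact (germInf_of_toInf (Filter.Eventually.of_forall fun _ => rfl)).symm

theorem isElem_const : IsElem (const N U) where
  pos x := Filter.Germ.coe_pos.trans (by simp)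
  psi _ _ := rfl
  elem := by
    intro α n φ v w xs ys hvw hxy
    obtain rfl : w = fun a => germInf U N.ψ fun _ => v a := funext fun a => (hvw a).eq_germInf U
    obtain rfl : ys = fun a => germInf U N.ψ fun _ => xs a := funext fun a => (hxy a).eq_germInf U
    exact (Filter.eventually_const.symm.trans
      (realize_boundedFormula_germInf N.isModel φ (fun a _ => v a) fun a _ => xs a).symm)

/-- The class of a family in `Ψ`. -/
def psiGerm (x : I → N.Psi) : (N.ultra U).Psi :=
  ⟨((fun i => x i : I → N) : Filter.Germ (U : Filter I) N),
    mem_psiSet_germ.2 (Filter.Eventually.of_forall fun i => (x i).2)⟩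

/-- Łoś's theorem for `(Ψ; <)`, obtained from the one for `(Γ, ψ)` by relativization. -/
theorem realize_psiGerm {α : Type*} (φ : ltLang.Formula α) (v : α → I → N.Psi) :
    φ.Realize (fun a => psiGerm U (v a)) ↔ ∀ᶠ i in U, φ.Realize fun a => v a i := by
  rw [← realize_formula_relForm (N.ultra U).isModel]
  have e : (fun a => toInf (N.ultra U).ψ (psiGerm U (v a))) =
      fun a => germInf U N.ψ fun i => toInf N.ψ (v a i) :=
    funext fun a => (germInf_of_toInf (Filter.Eventually.of_forall fun _ => rfl)).symm
  rw [e]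
  refine (realize_boundedFormula_zero (M := GammaInf (N.ultra U).ψ) (relForm φ) _
    fun k => germInf U N.ψ (k.elim0 : I → GammaInf N.ψ)).symm.trans ?_
  refine (realize_boundedFormula_germInf (U := U) N.isModel (relForm φ)
    (fun a i => toInf N.ψ (v a i)) fun k => k.elim0).trans
      (Filter.eventually_congr (Filter.Eventually.of_forall fun i => ?_))
  rw [← realize_formula_relForm N.isModel]
  exact realize_boundedFormula_zero _ _ _

end Const

end TlogModel

/-- The compactness principle of the proof: finite satisfiability enters as nonemptiness of the
members of a directed family. -/
theorem exists_ultrafilter_of_directed {ι X : Type*} [Nonempty ι] (s : ι → Set X)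
    (hd : Directed (· ⊇ ·) s) (hs : ∀ i, (s i).Nonempty) :
    ∃ U : Ultrafilter X, ∀ i, s i ∈ U := by
  have : Filter.NeBot (⨅ i, Filter.principal (s i)) :=
    Filter.iInf_neBot_of_directed' (fun i j => (hd i j).imp fun k hk =>
        ⟨Filter.principal_mono.2 hk.1, Filter.principal_mono.2 hk.2⟩)
      fun i => Filter.principal_neBot_iff.2 (hs i)
  refine ⟨Ultrafilter.of (⨅ i, Filter.principal (s i)), fun i => ?_⟩
  exact Ultrafilter.of_le _ (Filter.mem_iInf_of_mem i (Filter.mem_principal_self _))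

/-! ### Leading terms and finite satisfiability inside one model -/

section OneModel

variable {Γ : Type*} [AddCommGroup Γ] [LinearOrder Γ] [IsOrderedAddMonoid Γ] [Module ℚ Γ]
  {ψ : Γ → Γ}

/-- Leading terms of a linear combination of elements of `Ψ`. -/
theorem sum_sub_mem_small (h : IsModelTlog ψ) {ι : Type*} [DecidableEq ι] (S : Finset ι)
    (q : ι → ℚ) (y : ι → Γ) (hy : ∀ i, y i ∈ psiSet ψ) {k : ι} (hk : k ∈ S)
    (hmin : ∀ i ∈ S, i ≠ k → y k < y i) :
    ∑ i ∈ S, q i • y i - ((∑ i ∈ S, q i) • succ ψ (y k) - q k • (succ ψ (y k) - y k)) ∈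
      h.small (succ ψ (y k)) := by
  -- Split each `y i` as `s (y k) + (y i - s (y k))`. The term with `i = k` is kept; in the others
  -- `y i - s (y k)` is zero or has `ψ`-value `s (s (y k))`.
  have e : ∑ i ∈ S, q i • y i - ((∑ i ∈ S, q i) • succ ψ (y k) - q k • (succ ψ (y k) - y k)) =
      ∑ i ∈ S.erase k, q i • (y i - succ ψ (y k)) := by
    rw [Finset.sum_smul, ← Finset.add_sum_erase S _ hk, ← Finset.add_sum_erase S _ hk]
    simp only [smul_sub, Finset.sum_sub_distrib]
    abel
  rw [e]
  refine Submodule.sum_mem _ fun i hi => Submodule.smul_mem _ _ fun h0 => ?_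
  have h1 := h.succ_le (hy k) (hy i)
    (hmin i (Finset.mem_of_mem_erase hi) (Finset.ne_of_mem_erase hi))
  have h2 : succ ψ (y k) < y i := lt_of_le_of_ne h1 fun e => h0 (by rw [e, sub_self])
  rw [h.psi_sub_of_lt (h.succ_mem _) (hy i) h2]
  exact h.lt_succ (h.succ_mem _)

/-- The order and `ψ`-data of an element over a subspace containing `Ψ` are finitely satisfiable
in that subspace. -/
theorem exists_mem_of_finset (h : IsModelTlog ψ) {A : Submodule ℚ Γ} (hA : psiSet ψ ⊆ A) {b : Γ}
    (hb : b ∉ A) (F : Finset Γ) (hF : ∀ a ∈ F, a ∈ A) :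
    ∃ x ∈ A, ∀ a ∈ F, x ≠ a ∧ (a < x ↔ a < b) ∧ ψ (x - a) = ψ (b - a) := by
  classical
  rcases F.eq_empty_or_nonempty with rfl | hne
  · exact ⟨0, A.zero_mem, by simp⟩
  -- The value `c` below measures the best approximation to `b` by elements of `F`. Any `x` with `ψ
  -- (x - b) ≥ c` behaves like `b` towards the `a` with `ψ (b - a) < c`, so only the level `ψ (b -
  -- a) = c` needs care.
  obtain ⟨a₁, ha₁, hmax⟩ := F.exists_max_image (fun a => ψ (b - a)) hne
  obtain ⟨c, hc⟩ : ∃ c, c = ψ (b - a₁) := ⟨_, rfl⟩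
  have hbne : ∀ a ∈ A, b - a ≠ 0 := fun a ha h0 => hb (by rwa [sub_eq_zero.1 h0])
  have hcΨ : c ∈ psiSet ψ := hc ▸ h.psi_mem (hbne _ (hF _ ha₁))
  -- A sufficient criterion: `x` lies on the correct side of all `a` of level `c`, stays at
  -- `ψ`-distance at most `c` from them, and attains distance `c` from one of them. The last
  -- condition yields `ψ (x - b) ≥ c`.
  have main : ∀ x ∈ A, (∀ a ∈ F, ψ (b - a) = c → a < b → a < x ∧ ψ (x - a) ≤ c) →
      (∀ a ∈ F, ψ (b - a) = c → b < a → x < a ∧ ψ (x - a) ≤ c) →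
      (∃ u ∈ F, ψ (b - u) = c ∧ x ≠ u ∧ ψ (x - u) = c) →
      ∀ a ∈ F, x ≠ a ∧ (a < x ↔ a < b) ∧ ψ (x - a) = ψ (b - a) := by
    rintro x hx hlo hhi ⟨u, hu, hu1, hu2, hu3⟩ a ha
    have hxb : x - b ≠ 0 := by
      rw [← neg_sub]; exact neg_ne_zero.2 (hbne x hx)
    have hxb' : c ≤ ψ (x - b) := by
      have := h.ac1 (x - u) (u - b) (sub_ne_zero.2 hu2)
        (by rw [← neg_sub]; exact neg_ne_zero.2 (hbne u (hF u hu))) (by simpa using hxb)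
      rwa [sub_add_sub_cancel, hu3, ← h.psi_sub_comm (sub_ne_zero.1 (hbne u (hF u hu))), hu1,
        min_self] at this
    have hab := hbne a (hF a ha)
    have e : x - a = (b - a) + (x - b) := by abel
    rcases lt_or_eq_of_le (hc ▸ hmax a ha : ψ (b - a) ≤ c) with h1 | h1
    · have hs : x - b ∈ h.small (ψ (b - a)) := fun _ => h1.trans_le hxb'
      have h2 := psi_add_small h.toIsAsymptoticCouple hab hs
      have h3 := pos_add_small h.toIsHAsymptoticCouple hab hs
      rw [← e] at h2 h3
      rw [sub_pos, sub_pos] at h3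
      exact ⟨sub_ne_zero.1 h2.1, h3, h2.2⟩
    · have hge : x ≠ a → c ≤ ψ (x - a) := by
        intro hxa
        have := h.ac1 (b - a) (x - b) hab hxb (by rw [← e]; exact sub_ne_zero.2 hxa)
        rw [← e, h1] at this
        exact (le_min le_rfl hxb').trans this
      rcases lt_or_gt_of_ne (sub_ne_zero.1 hab) with h2 | h2
      · obtain ⟨h3, h4⟩ := hhi a ha h1 h2
        exact ⟨h3.ne, iff_of_false h3.not_gt h2.not_gt,
          by rw [h1]; exact le_antisymm h4 (hge h3.ne)⟩
      · obtain ⟨h3, h4⟩ := hlo a ha h1 h2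
        exact ⟨h3.ne', iff_of_true h3 h2, by rw [h1]; exact le_antisymm h4 (hge h3.ne')⟩
  -- The inclusion `Ψ ⊆ A` supplies a positive step of size exactly `c` inside `A`. The point sought
  -- is the midpoint of the nearest level-`c` elements `lo < b < hi` if both exist, and otherwise
  -- `lo + e` or `hi - e`.
  obtain ⟨e, heA, he0, hec⟩ := h.exists_pos_psi_eq_of_subset (A := A.toAddSubgroup) hA hcΨ
  by_cases hL : (F.filter fun a => ψ (b - a) = c ∧ a < b).Nonempty
  · obtain ⟨lo, hlo, hlomax⟩ := Finset.exists_max_image _ id hL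
    simp only [Finset.mem_filter, id] at hlo hlomax
    obtain ⟨hloF, hloc, hlob⟩ := hlo
    have hlo' : ∀ x, lo < x → ψ (x - lo) = c →
        ∀ a ∈ F, ψ (b - a) = c → a < b → a < x ∧ ψ (x - a) ≤ c := by
      intro x hx hxc a ha hac hab
      have hle := hlomax a ⟨ha, hac, hab⟩
      refine ⟨hle.trans_lt hx, ?_⟩
      rw [← hxc]
      exact h.hc _ _ (sub_pos.2 hx) (sub_le_sub_left hle x)
    by_cases hH : (F.filter fun a => ψ (b - a) = c ∧ b < a).Nonempty
    · obtain ⟨hi, hhi, hhimin⟩ := Finset.exists_min_image _ id hH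
      simp only [Finset.mem_filter, id] at hhi hhimin
      obtain ⟨hhiF, hhic, hhib⟩ := hhi
      have hlh : 0 < hi - lo := sub_pos.2 (hlob.trans hhib)
      have hψ : ψ (hi - lo) = c := by
        apply le_antisymm
        · rw [← hloc]
          exact h.hc _ _ (sub_pos.2 hlob) (sub_le_sub_right hhib.le lo)
        · have := h.ac1 (hi - b) (b - lo) (sub_ne_zero.2 hhib.ne') (sub_ne_zero.2 hlob.ne')
            (by simpa using hlh.ne')
          rwa [sub_add_sub_cancel, h.psi_sub_comm hhib.ne', hhic, hloc, min_self] at this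
      have hhalf : 0 < (2⁻¹ : ℚ) • (hi - lo) := rat_smul_pos (by norm_num) hlh
      have hhalfψ : ψ ((2⁻¹ : ℚ) • (hi - lo)) = c := by
        rw [h.psi_smul (by norm_num) hlh.ne', hψ]
      have e1 : lo + (2⁻¹ : ℚ) • (hi - lo) - lo = (2⁻¹ : ℚ) • (hi - lo) := by abel
      have e2 : hi - (lo + (2⁻¹ : ℚ) • (hi - lo)) = (2⁻¹ : ℚ) • (hi - lo) := by module
      have hxlo : lo < lo + (2⁻¹ : ℚ) • (hi - lo) := lt_add_of_pos_right _ hhalf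
      have hxhi : lo + (2⁻¹ : ℚ) • (hi - lo) < hi := by rw [← sub_pos, e2]; exact hhalf
      have hxA : lo + (2⁻¹ : ℚ) • (hi - lo) ∈ A :=
        A.add_mem (hF _ hloF) (A.smul_mem _ (A.sub_mem (hF _ hhiF) (hF _ hloF)))
      refine ⟨_, hxA, main _ hxA (hlo' _ hxlo (by rw [e1, hhalfψ])) ?_
        ⟨lo, hloF, hloc, hxlo.ne', by rw [e1, hhalfψ]⟩⟩
      intro a ha hac hab
      have hle := hhimin a ⟨ha, hac, hab⟩
      refine ⟨hxhi.trans_le hle, ?_⟩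
      have h1 := h.hc _ _ (sub_pos.2 hxhi) (sub_le_sub_right hle _)
      rwa [e2, hhalfψ, h.psi_sub_comm (hxhi.trans_le hle).ne'] at h1
    · have hxA : lo + e ∈ A := A.add_mem (hF _ hloF) heA
      have hxlo : lo < lo + e := lt_add_of_pos_right _ he0
      have e1 : lo + e - lo = e := by abel
      refine ⟨_, hxA, main _ hxA (hlo' _ hxlo (by rw [e1, hec])) ?_
        ⟨lo, hloF, hloc, hxlo.ne', by rw [e1, hec]⟩⟩
      intro a ha hac hab
      exact absurd ⟨a, Finset.mem_filter.2 ⟨ha, hac, hab⟩⟩ hH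
  · have hH : (F.filter fun a => ψ (b - a) = c ∧ b < a).Nonempty := by
      refine ⟨a₁, Finset.mem_filter.2 ⟨ha₁, hc.symm, ?_⟩⟩
      rcases lt_or_gt_of_ne (sub_ne_zero.1 (hbne _ (hF _ ha₁))) with h2 | h2
      · exact h2
      · exact absurd ⟨a₁, Finset.mem_filter.2 ⟨ha₁, hc.symm, h2⟩⟩ hL
    obtain ⟨hi, hhi, hhimin⟩ := Finset.exists_min_image _ id hH
    simp only [Finset.mem_filter, id] at hhi hhimin
    obtain ⟨hhiF, hhic, hhib⟩ := hhi
    have hxA : hi - e ∈ A := A.sub_mem (hF _ hhiF) heA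
    have hxhi : hi - e < hi := sub_lt_self _ he0
    have e2 : hi - (hi - e) = e := by abel
    refine ⟨_, hxA, main _ hxA ?_ ?_ ⟨hi, hhiF, hhic, hxhi.ne, ?_⟩⟩
    · intro a ha hac hab
      exact absurd ⟨a, Finset.mem_filter.2 ⟨ha, hac, hab⟩⟩ hL
    · intro a ha hac hab
      have hle := hhimin a ⟨ha, hac, hab⟩
      refine ⟨hxhi.trans_le hle, ?_⟩
      have h1 := h.hc _ _ (sub_pos.2 hxhi) (sub_le_sub_right hle _)
      rwa [e2, hec, h.psi_sub_comm (hxhi.trans_le hle).ne'] at h1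
    · rw [h.psi_sub_comm hxhi.ne, e2, hec]

end OneModel

/-! ### Partial isomorphisms as linear relations -/

namespace TlogModel

variable {M N N' : TlogModel.{u}}

/-- Partial isomorphisms between models, as relations, whose trace on `Ψ` is partial elementary
for the language `{<}`. -/
structure BackForth (R : Submodule ℚ (M × N)) : Prop where
  pos : ∀ {x y}, (x, y) ∈ R → (0 < x ↔ 0 < y)
  psi : ∀ {x y}, (x, y) ∈ R → x ≠ 0 → (M.ψ x, N.ψ y) ∈ R
  succ : ∀ {x y}, (x, y) ∈ R → (succ M.ψ x, succ N.ψ y) ∈ R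
  mem : ∀ {x y}, (x, y) ∈ R → (x ∈ M.Psi ↔ y ∈ N.Psi)
  pred : ∀ {c d}, c ∈ M.Psi → d ∈ N.Psi → (AsympCouple.succ M.ψ c, AsympCouple.succ N.ψ d) ∈ R →
    (c, d) ∈ R
  elem : ∀ {α : Type u} (φ : ltLang.Formula α) (v : α → M.Psi) (w : α → N.Psi),
    (∀ a, ((v a : M), (w a : N)) ∈ R) → (φ.Realize v ↔ φ.Realize w)

/-- Partial isomorphisms defined on all of `Ψ`, where they are elementary for the language
`{<}`. -/
structure IsFull (R : Submodule ℚ (M × N)) (h : M.Psi → N.Psi) : Prop where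
  pos : ∀ {x y}, (x, y) ∈ R → (0 < x ↔ 0 < y)
  psi : ∀ {x y}, (x, y) ∈ R → x ≠ 0 → (M.ψ x, N.ψ y) ∈ R
  elem : ∀ φ : ltLang.Formula M.Psi, φ.Realize (id : M.Psi → M.Psi) ↔ φ.Realize h
  graph : ∀ c : M.Psi, ((c : M), (h c : N)) ∈ R

section PosRel

variable {R : Submodule ℚ (M × N)} (hR : ∀ {x y}, (x, y) ∈ R → (0 < x ↔ 0 < y))

include hR

/-- Zero is the element for which neither it nor its negative is positive. Hence a linear relation
preserving positivity is automatically the graph of an injective order-preserving map. -/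
theorem rel_eq_zero_iff {x : M} {y : N} (h : (x, y) ∈ R) : x = 0 ↔ y = 0 := by
  have h1 := hR h
  have h2 : 0 < -x ↔ 0 < -y := hR (R.neg_mem h)
  rw [neg_pos, neg_pos] at h2
  constructor
  · rintro rfl
    exact le_antisymm (not_lt.1 fun h => lt_irrefl _ (h1.2 h))
      (not_lt.1 fun h => lt_irrefl _ (h2.2 h))
  · rintro rfl
    exact le_antisymm (not_lt.1 fun h => lt_irrefl _ (h1.1 h))
      (not_lt.1 fun h => lt_irrefl _ (h2.1 h))

theorem rel_eq_iff {x x' : M} {y y' : N} (h : (x, y) ∈ R) (h' : (x', y') ∈ R) :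
    x = x' ↔ y = y' := by
  have := rel_eq_zero_iff hR (x := x - x') (y := y - y') (R.sub_mem h h')
  rwa [sub_eq_zero, sub_eq_zero] at this

theorem rel_lt_iff {x x' : M} {y y' : N} (h : (x, y) ∈ R) (h' : (x', y') ∈ R) :
    x < x' ↔ y < y' := by
  have := hR (x := x' - x) (y := y' - y) (R.sub_mem h' h)
  rwa [sub_pos, sub_pos] at this

end PosRel

section PsiMap

variable {h : M.Psi → N.Psi}
  (hh : ∀ φ : ltLang.Formula M.Psi, φ.Realize (id : M.Psi → M.Psi) ↔ φ.Realize h)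

include hh

theorem psiMap_lt {c d : M.Psi} : (c : M) < d ↔ (h c : N) < h d := by
  have := hh (ltForm c d)
  rwa [realize_ltForm, realize_ltForm] at this

/-- On `Ψ` the function `s` is the immediate successor, hence definable from the order. -/
theorem psiMap_succ {c d : M.Psi} (e : (d : M) = succ M.ψ c) : (h d : N) = succ N.ψ (h c) := by
  have h1 : (c : M) < d := by rw [e]; exact M.isModel.lt_succ c.2
  have h2 := (hh (noneBetween c d))
  rw [realize_noneBetween, realize_noneBetween] at h2
  have h3 := h2.1 fun z hz hz' => by
    have hz : (c : M) < z := hz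
    have hz' : (z : M) < d := hz'
    rw [e] at hz'
    exact absurd hz' (not_lt.2 (M.isModel.succ_le c.2 z.2 hz))
  refine le_antisymm (not_lt.1 fun h4 => ?_)
    (N.isModel.succ_le (h c).2 (h d).2 ((psiMap_lt hh).1 h1))
  exact h3 ⟨succ N.ψ (h c), N.isModel.succ_mem _⟩ (N.isModel.lt_succ (h c).2) h4

end PsiMap

/-- When the domain contains all of `Ψ`, the clauses on `s`, `p` and `Ψ` come for free: `s y` is the
unique `d ≠ y` with `ψ (y - d) = d`, and both membership in `Ψ` and predecessors are recovered from
`s` and its injectivity on `Ψ`. -/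
theorem IsFull.backForth {R : Submodule ℚ (M × N)} {h : M.Psi → N.Psi} (hR : IsFull R h) :
    BackForth R := by
  have hsucc : ∀ {x y}, (x, y) ∈ R → (succ M.ψ x, succ N.ψ y) ∈ R := by
    intro x y hxy
    obtain ⟨h1, h2⟩ := M.isModel.succ_spec x
    have hg := hR.graph ⟨succ M.ψ x, M.isModel.succ_mem x⟩
    have hs : (x - succ M.ψ x, y - h ⟨succ M.ψ x, M.isModel.succ_mem x⟩) ∈ R := R.sub_mem hxy hg
    have h3 := hR.psi hs (sub_ne_zero.2 h1)
    rw [h2] at h3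
    have h4 := (rel_eq_iff hR.pos h3 hg).1 rfl
    rw [N.isModel.succ_eq (fun e => h1 ((rel_eq_iff hR.pos hxy hg).2 e)) h4]
    exact hg
  have hzero : (succ M.ψ 0, succ N.ψ 0) ∈ R := hsucc R.zero_mem
  refine ⟨hR.pos, hR.psi, hsucc, ?_, ?_, ?_⟩
  · intro x y hxy
    constructor
    · intro hx
      rw [(rel_eq_iff hR.pos hxy (hR.graph ⟨x, hx⟩)).1 rfl]
      exact (h ⟨x, hx⟩).2
    · intro hy
      by_cases h0 : succ M.ψ x = succ M.ψ 0
      · have h1 := N.isModel.succ_zero_lt_succ hy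
        rw [(rel_eq_iff hR.pos (hsucc hxy) hzero).1 h0] at h1
        exact absurd h1 (lt_irrefl _)
      · obtain ⟨c, hc, e⟩ := M.isModel.exists_pred (M.isModel.succ_mem x) h0
        have hg := hR.graph ⟨c, hc⟩
        have h1 := (rel_eq_iff hR.pos (hsucc hg) (hsucc hxy)).1 e
        have h2 := N.isModel.succ_inj (h ⟨c, hc⟩).2 hy h1
        rw [(rel_eq_iff hR.pos hxy hg).2 h2.symm]
        exact hc
  · intro c d hc hd hcd
    have hg := hR.graph ⟨c, hc⟩
    have h1 := (rel_eq_iff hR.pos (hsucc hg) hcd).1 rfl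
    rw [← N.isModel.succ_inj (h ⟨c, hc⟩).2 hd h1]
    exact hg
  · intro α φ v w hvw
    have e : w = h ∘ v := funext fun a =>
      Subtype.ext ((rel_eq_iff hR.pos (hvw a) (hR.graph (v a))).1 rfl)
    have h1 := hR.elem (φ.relabel v)
    rw [Language.Formula.realize_relabel, Language.Formula.realize_relabel] at h1
    rw [e]
    exact h1

section Push

/-- The image of a relation under a map of its second component. -/
def push (R : Submodule ℚ (M × N)) (j : N →ₗ[ℚ] N') : Submodule ℚ (M × N') :=
  R.map (LinearMap.prodMap LinearMap.id j)

theorem mem_push {R : Submodule ℚ (M × N)} {j : N →ₗ[ℚ] N'} {x : M} {y : N'} :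
    (x, y) ∈ push R j ↔ ∃ z, (x, z) ∈ R ∧ j z = y := by
  constructor
  · rintro ⟨⟨x', z⟩, hz, e⟩
    obtain ⟨rfl, rfl⟩ := Prod.mk.inj e
    exact ⟨z, hz, rfl⟩
  · rintro ⟨z, hz, rfl⟩
    exact ⟨(x, z), hz, rfl⟩

theorem mem_push_of_mem {R : Submodule ℚ (M × N)} (j : N →ₗ[ℚ] N') {x : M} {y : N}
    (h : (x, y) ∈ R) : (x, j y) ∈ push R j := mem_push.2 ⟨y, h, rfl⟩

/-- The map induced on `Ψ` by an elementary embedding. -/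
def IsElem.psiMap {j : N →ₗ[ℚ] N'} (hj : IsElem j) (c : N.Psi) : N'.Psi :=
  ⟨j c, (hj.mem c).2 c.2⟩

theorem IsElem.realize_psiMap {j : N →ₗ[ℚ] N'} (hj : IsElem j) {α : Type u}
    (φ : ltLang.Formula α) (v : α → N.Psi) : φ.Realize v ↔ φ.Realize fun a => hj.psiMap (v a) :=
  Elementary.realize_ltFormula hj.elem φ fun _ => (LinearMap.mem_graph_iff _ _).2 rfl

theorem BackForth.push {R : Submodule ℚ (M × N)} (hR : BackForth R) {j : N →ₗ[ℚ] N'}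
    (hj : IsElem j) : BackForth (push R j) := by
  refine ⟨?_, ?_, ?_, ?_, ?_, ?_⟩
  · intro x y hxy
    obtain ⟨z, hz, rfl⟩ := mem_push.1 hxy
    rw [hR.pos hz, hj.pos]
  · intro x y hxy hx
    obtain ⟨z, hz, rfl⟩ := mem_push.1 hxy
    rw [hj.psi _ fun h0 => hx ((rel_eq_zero_iff hR.pos hz).2 h0)]
    exact mem_push_of_mem j (hR.psi hz hx)
  · intro x y hxy
    obtain ⟨z, hz, rfl⟩ := mem_push.1 hxy
    rw [hj.succ]
    exact mem_push_of_mem j (hR.succ hz)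
  · intro x y hxy
    obtain ⟨z, hz, rfl⟩ := mem_push.1 hxy
    rw [hj.mem, hR.mem hz]
  · intro c d hc hd hcd
    obtain ⟨z, hz, e⟩ := mem_push.1 hcd
    have hzΨ : z ∈ N.Psi := (hR.mem hz).1 (M.isModel.succ_mem c)
    -- The predecessor `d` is only given in `N'`. It has to be found in `N`, which is possible
    -- because `z` is not the least element of `Ψ`.
    have h0 : z ≠ AsympCouple.succ N.ψ 0 := by
      rintro rfl
      have h1 := N'.isModel.succ_zero_lt_succ hd
      rw [← e, ← hj.succ, map_zero] at h1
      exact lt_irrefl _ h1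
    obtain ⟨d', hd', rfl⟩ := N.isModel.exists_pred hzΨ h0
    rw [← hj.succ] at e
    rw [← N'.isModel.succ_inj ((hj.mem d').2 hd') hd e]
    exact mem_push_of_mem j (hR.pred hc hd' hz)
  · intro α φ v w hvw
    choose z hz hzw using fun a => mem_push.1 (hvw a)
    have hzΨ : ∀ a, z a ∈ N.Psi := fun a => (hR.mem (hz a)).1 (v a).2
    rw [hR.elem φ v (fun a => ⟨z a, hzΨ a⟩) hz, hj.realize_psiMap]
    have e : w = fun a => hj.psiMap ⟨z a, hzΨ a⟩ := funext fun a => Subtype.ext (hzw a).symm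
    rw [e]

theorem IsFull.push {R : Submodule ℚ (M × N)} {h : M.Psi → N.Psi} (hR : IsFull R h)
    {j : N →ₗ[ℚ] N'} (hj : IsElem j) : IsFull (push R j) fun c => hj.psiMap (h c) where
  pos := (hR.backForth.push hj).pos
  psi := (hR.backForth.push hj).psi
  elem φ := (hR.elem φ).trans (hj.realize_psiMap φ h)
  graph c := mem_push_of_mem j (hR.graph c)

end Push

end TlogModel

namespace TlogModel

variable {M N N' : TlogModel.{u}}

/-! ### Extending a partial elementary map to all of `Ψ` -/

section PsiExtension

variable {T : M.Psi → N.Psi → Prop}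
  (hT : ∀ {α : Type u} (φ : ltLang.Formula α) (v : α → M.Psi) (w : α → N.Psi),
    (∀ a, T (v a) (w a)) → (φ.Realize v ↔ φ.Realize w))

include hT

theorem rel_psi_unique {c : M.Psi} {d d' : N.Psi} (h : T c d) (h' : T c d') : d = d' := by
  have h1 := hT (α := ULift Bool)
    ((Language.Term.var ⟨true⟩ : ltLang.Term (ULift Bool)).equal (.var ⟨false⟩))
    (fun _ => c) (fun b => if b.down then d else d') (by rintro ⟨_ | _⟩ <;> simpa)
  rw [Language.Formula.realize_equal, Language.Formula.realize_equal] at h1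
  simpa using h1

/-- Only finitely many variables are free in `φ`. Those outside the domain of `T` are quantified
away existentially, the resulting formula over the domain of `T` is transferred, and its witnesses
give the new values. -/
theorem exists_realize_extending {φ : ltLang.Formula M.Psi}
    (hφ : φ.Realize (id : M.Psi → M.Psi)) :
    ∃ g : M.Psi → N.Psi, φ.Realize g ∧ ∀ c d, T c d → g c = d := by
  classical
  have e0 : Nonempty N.Psi := ⟨⟨succ N.ψ 0, N.isModel.succ_mem 0⟩⟩
  choose f hf using fun c : {c // ∃ d, T c d} => c.2
  let β := {c : φ.freeVarFinset // ¬ ∃ d, T c d}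
  let r : φ.freeVarFinset → {c // ∃ d, T c d} ⊕ β := fun c =>
    if hc : ∃ d, T c d then Sum.inl ⟨c, hc⟩ else Sum.inr ⟨c, hc⟩
  let φ' : ltLang.Formula ({c // ∃ d, T c d} ⊕ β) := φ.restrictFreeVar r
  have h1 : (φ'.iExs β).Realize fun c : {c // ∃ d, T c d} => c.1 := by
    rw [Language.Formula.realize_iExs]
    refine ⟨fun c => c.1.1, ?_⟩
    refine (Language.BoundedFormula.realize_restrictFreeVar (id : M.Psi → M.Psi) ?_).2 hφ
    intro a
    by_cases hc : ∃ d, T a d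
    · simp only [r, dif_pos hc]; rfl
    · simp only [r, dif_neg hc]; rfl
  have h2 := (hT _ _ f hf).1 h1
  rw [Language.Formula.realize_iExs] at h2
  obtain ⟨i, hi⟩ := h2
  let g : M.Psi → N.Psi := fun c =>
    if hc : ∃ d, T c d then f ⟨c, hc⟩
    else if hm : c ∈ φ.freeVarFinset then i ⟨⟨c, hm⟩, hc⟩ else e0.some
  refine ⟨g, ?_, fun c d hcd => ?_⟩
  · refine (Language.BoundedFormula.realize_restrictFreeVar g ?_).1 hi
    intro a
    by_cases hc : ∃ d, T a d
    · simp only [r, g, dif_pos hc]; rfl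
    · simp only [r, g, dif_neg hc, dif_pos a.2]; rfl
  · have hc : ∃ d, T c d := ⟨d, hcd⟩
    simp only [g, dif_pos hc]
    exact rel_psi_unique hT (hf ⟨c, hc⟩) hcd

/-- A partial elementary map on `Ψ` extends to all of `Ψ`, with values in an ultrapower. -/
theorem exists_psi_extension :
    ∃ (I : Type u) (U : Ultrafilter I) (h : M.Psi → (N.ultra U).Psi),
      (∀ φ : ltLang.Formula M.Psi, φ.Realize (id : M.Psi → M.Psi) ↔ φ.Realize h) ∧
        ∀ c d, T c d → (h c : N.ultra U) = const N U d := by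
  -- The index set is the set of all maps `Ψ_M → Ψ_N`. An ultrafilter containing all these sets
  -- makes evaluation `c ↦ (g ↦ g c)` an elementary map that extends `T`.
  let s : {φ : ltLang.Formula M.Psi // φ.Realize (id : M.Psi → M.Psi)} → Set (M.Psi → N.Psi) :=
    fun φ => {g | φ.1.Realize g ∧ ∀ c d, T c d → g c = d}
  have : Nonempty {φ : ltLang.Formula M.Psi // φ.Realize (id : M.Psi → M.Psi)} :=
    ⟨⟨⊤, Language.Formula.realize_top.2 trivial⟩⟩
  obtain ⟨U, hU⟩ := exists_ultrafilter_of_directed s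
    (fun φ θ => ⟨⟨φ.1 ⊓ θ.1, Language.Formula.realize_inf.2 ⟨φ.2, θ.2⟩⟩,
      fun g hg => ⟨(Language.Formula.realize_inf.1 hg.1).1, hg.2⟩,
      fun g hg => ⟨(Language.Formula.realize_inf.1 hg.1).2, hg.2⟩⟩)
    fun φ => exists_realize_extending hT φ.2
  refine ⟨M.Psi → N.Psi, U, fun c => psiGerm U fun g => g c, ?_, ?_⟩
  · have key : ∀ φ : ltLang.Formula M.Psi, φ.Realize (id : M.Psi → M.Psi) →
        φ.Realize fun c => psiGerm U fun g : M.Psi → N.Psi => g c := by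
      intro φ hφ
      rw [realize_psiGerm]
      filter_upwards [hU ⟨φ, hφ⟩] with g hg using hg.1
    intro φ
    refine ⟨key φ, fun h => by_contra fun hn => ?_⟩
    have := key φ.not (Language.Formula.realize_not.2 hn)
    exact Language.Formula.realize_not.1 this h
  · intro c d hcd
    refine germ_eq_iff.2 ?_
    obtain ⟨φ⟩ := this
    filter_upwards [hU φ] with g hg
    rw [hg.2 c d hcd]

end PsiExtension

/-! ### Adjoining all of `Ψ` to a partial isomorphism -/

section AdjoinPsi

/-- Closure under `p`, contraposed. It guarantees that successors of elements outside the domain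
never collide with values coming from the domain. -/
theorem BackForth.succ_not_mem {R : Submodule ℚ (M × N)} (hR : BackForth R) {c : M}
    (hc : c ∈ M.Psi) (hn : ¬ ∃ d, (c, d) ∈ R) : ¬ ∃ d, (AsympCouple.succ M.ψ c, d) ∈ R := by
  rintro ⟨d, hd⟩
  have hdΨ := (hR.mem hd).1 (M.isModel.succ_mem c)
  have h0 : d ≠ AsympCouple.succ N.ψ 0 := by
    rintro rfl
    have h1 := (rel_eq_iff hR.pos hd (hR.succ R.zero_mem)).2 rfl
    exact (M.isModel.succ_zero_lt_succ hc).ne' h1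
  obtain ⟨d', hd', rfl⟩ := N.isModel.exists_pred hdΨ h0
  exact hn ⟨d', hR.pred hc hd' hd⟩

variable {R : Submodule ℚ (M × N)} (hR : BackForth R) {h : M.Psi → N.Psi}
  (hh : ∀ φ : ltLang.Formula M.Psi, φ.Realize (id : M.Psi → M.Psi) ↔ φ.Realize h)
  (hRh : ∀ (c : M.Psi) (d : N), ((c : M), d) ∈ R → d = h c)

include hR hh hRh

/-- The contribution of an element of `R` near an element of `Ψ` outside the domain of `R`. -/
theorem leading_cases {a : M} {a' : N} (ha : (a, a') ∈ R) {c d : M.Psi}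
    (hc : ¬ ∃ y, ((c : M), y) ∈ R) (hd : (d : M) = succ M.ψ c) (Q : ℚ) :
    (a + Q • (d : M) ∈ M.isModel.small d ∧ a' + Q • (h d : N) ∈ N.isModel.small (h d)) ∨
    ∃ e e', (e, e') ∈ R ∧ e ≠ 0 ∧ M.ψ e < d ∧ N.ψ e' < h d ∧
      a + Q • (d : M) - e ∈ M.isModel.small (M.ψ e) ∧
      a' + Q • (h d : N) - e' ∈ N.isModel.small (N.ψ e') := by
  have hdR : ¬ ∃ y, ((d : M), y) ∈ R := hd ▸ hR.succ_not_mem c.2 hc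
  have hsdR : ¬ ∃ y, (AsympCouple.succ M.ψ d, y) ∈ R := hR.succ_not_mem d.2 hdR
  have hmap : ∀ {x : M.Psi} {y : N}, ((x : M), y) ∈ R → ((x : M) < d ↔ y < h d) := by
    intro x y hxy
    rw [hRh x y hxy]
    exact psiMap_lt hh
  have hmap' : ∀ {x : M.Psi} {y : N} (z : M.Psi), ((x : M), y) ∈ R →
      ((z : M) < x ↔ (h z : N) < y) := by
    intro x y z hxy
    rw [hRh x y hxy]
    exact psiMap_lt hh
  by_cases hQ : Q = 0
  · subst hQ
    simp only [zero_smul, add_zero]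
    by_cases h0 : a = 0
    · have h0' := (rel_eq_zero_iff hR.pos ha).1 h0
      subst h0 h0'
      exact Or.inl ⟨Submodule.zero_mem _, Submodule.zero_mem _⟩
    have h0' : a' ≠ 0 := fun h1 => h0 ((rel_eq_zero_iff hR.pos ha).2 h1)
    have hψ := hR.psi ha h0
    have hψΨ := M.isModel.psi_mem h0
    rcases lt_trichotomy (M.ψ a) d with h1 | h1 | h1
    · refine Or.inr ⟨a, a', ha, h0, h1, (hmap (x := ⟨_, hψΨ⟩) hψ).1 h1, ?_, ?_⟩ <;>
        rw [sub_self] <;> exact Submodule.zero_mem _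
    · exact absurd ⟨_, h1 ▸ hψ⟩ hdR
    · exact Or.inl ⟨fun _ => h1, fun _ => (hmap' (x := ⟨_, hψΨ⟩) d hψ).1 h1⟩
  -- With `α = -Q⁻¹ a`, the element is `-Q (α - d)`, so everything depends on comparing `s α` with
  -- `d`. If `s α < d`, then `Q (s α - α)`, which lies in the domain, is the leading term; equality
  -- is excluded since `d` is outside the domain.
  · have hα : ((-Q⁻¹) • a, (-Q⁻¹) • a') ∈ R := R.smul_mem _ ha
    have ea : a = -(Q • ((-Q⁻¹) • a)) := by
      rw [smul_smul, mul_neg, mul_inv_cancel₀ hQ, neg_one_smul, neg_neg]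
    have ea' : a' = -(Q • ((-Q⁻¹) • a')) := by
      rw [smul_smul, mul_neg, mul_inv_cancel₀ hQ, neg_one_smul, neg_neg]
    generalize (-Q⁻¹) • a = α at hα ea
    generalize (-Q⁻¹) • a' = α' at hα ea'
    subst ea ea'
    have hs := hR.succ hα
    have hsΨ := M.isModel.succ_mem α
    rcases lt_trichotomy (AsympCouple.succ M.ψ α) d with h1 | h1 | h1
    · have h1' := (hmap (x := ⟨_, hsΨ⟩) hs).1 h1
      obtain ⟨h2, h3⟩ := M.isModel.succ_spec α
      obtain ⟨h2', h3'⟩ := N.isModel.succ_spec α'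
      have h4 : M.ψ (Q • (AsympCouple.succ M.ψ α - α)) = AsympCouple.succ M.ψ α := by
        rw [M.isModel.psi_smul hQ (sub_ne_zero.2 h2.symm), M.isModel.psi_sub_comm h2.symm, h3]
      have h4' : N.ψ (Q • (AsympCouple.succ N.ψ α' - α')) = AsympCouple.succ N.ψ α' := by
        rw [N.isModel.psi_smul hQ (sub_ne_zero.2 h2'.symm), N.isModel.psi_sub_comm h2'.symm, h3']
      refine Or.inr ⟨Q • (AsympCouple.succ M.ψ α - α), Q • (AsympCouple.succ N.ψ α' - α'),
        R.smul_mem _ (R.sub_mem hs hα), smul_ne_zero hQ (sub_ne_zero.2 h2.symm), by rwa [h4],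
        by rwa [h4'], ?_, ?_⟩
      · have e : -(Q • α) + Q • (d : M) - Q • (AsympCouple.succ M.ψ α - α) =
            Q • ((d : M) - AsympCouple.succ M.ψ α) := by module
        rw [e, h4]
        refine Submodule.smul_mem _ _ fun _ => ?_
        rw [M.isModel.psi_sub_of_lt hsΨ d.2 h1]
        exact M.isModel.lt_succ hsΨ
      · have e : -(Q • α') + Q • (h d : N) - Q • (AsympCouple.succ N.ψ α' - α') =
            Q • ((h d : N) - AsympCouple.succ N.ψ α') := by module
        rw [e, h4']
        refine Submodule.smul_mem _ _ fun _ => ?_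
        rw [N.isModel.psi_sub_of_lt (N.isModel.succ_mem _) (h d).2 h1']
        exact N.isModel.lt_succ (N.isModel.succ_mem _)
    · exact absurd ⟨_, h1 ▸ hs⟩ hdR
    -- Since `s d` is outside the domain as well, `d < s α` improves to `s d < s α`. The successor
    -- identity then gives `ψ (α - d) = s d > d`.
    · have h2 : AsympCouple.succ M.ψ d < AsympCouple.succ M.ψ α :=
        lt_of_le_of_ne (M.isModel.succ_le d.2 hsΨ h1) fun e => hsdR ⟨_, e ▸ hs⟩
      have h2' : AsympCouple.succ N.ψ (h d) < AsympCouple.succ N.ψ α' := by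
        rw [← psiMap_succ hh (c := d) (d := ⟨_, M.isModel.succ_mem d⟩) rfl]
        exact (hmap' (x := ⟨_, hsΨ⟩) ⟨_, M.isModel.succ_mem d⟩ hs).1 h2
      have e : -(Q • α) + Q • (d : M) = -(Q • (α - d)) := by module
      have e' : -(Q • α') + Q • (h d : N) = -(Q • (α' - h d)) := by module
      rw [e, e']
      refine Or.inl ⟨Submodule.neg_mem _ (Submodule.smul_mem _ _ fun _ => ?_),
        Submodule.neg_mem _ (Submodule.smul_mem _ _ fun _ => ?_)⟩
      · rw [(M.isModel.psi_sub_of_succ_lt h2).2]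
        exact M.isModel.lt_succ d.2
      · rw [(N.isModel.psi_sub_of_succ_lt h2').2]
        exact N.isModel.lt_succ (h d).2

omit hR hh hRh in
-- Used to transfer sign and `ψ`-value through matching leading terms `e`, `e'`.
theorem decomposition {e x : M} {e' y : N} (h0 : e ≠ 0) (h0' : e' ≠ 0) (hee : 0 < e ↔ 0 < e')
    (hx : x - e ∈ M.isModel.small (M.ψ e)) (hy : y - e' ∈ N.isModel.small (N.ψ e')) :
    (0 < x ↔ 0 < y) ∧ M.ψ x = M.ψ e ∧ N.ψ y = N.ψ e' := by
  have h1 := psi_add_small M.isModel.toIsAsymptoticCouple h0 hx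
  have h2 := psi_add_small N.isModel.toIsAsymptoticCouple h0' hy
  have h3 := pos_add_small M.isModel.toIsHAsymptoticCouple h0 hx
  have h4 := pos_add_small N.isModel.toIsHAsymptoticCouple h0' hy
  rw [add_sub_cancel] at h1 h2 h3 h4
  exact ⟨h3.trans (hee.trans h4.symm), h1.2, h2.2⟩

/-- A partial isomorphism extends along a compatible elementary map defined on all of `Ψ`. -/
theorem exists_isFull : ∃ R' : Submodule ℚ (M × N), R ≤ R' ∧ IsFull R' h := by
  classical
  let C := {c : M.Psi // ¬ ∃ y, ((c : M), y) ∈ R}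
  let R' := R ⊔ Submodule.span ℚ (Set.range fun c : C => ((c.1 : M), (h c.1 : N)))
  have hle : R ≤ R' := le_sup_left
  have hgraph : ∀ c : M.Psi, ((c : M), (h c : N)) ∈ R' := by
    intro c
    by_cases hc : ∃ y, ((c : M), y) ∈ R
    · obtain ⟨y, hy⟩ := hc
      rw [← hRh c y hy]
      exact hle hy
    · exact (le_sup_right : _ ≤ R') (Submodule.subset_span ⟨⟨c, hc⟩, rfl⟩)
  have key : ∀ {x y}, (x, y) ∈ R' → (0 < x ↔ 0 < y) ∧ (x ≠ 0 → (M.ψ x, N.ψ y) ∈ R') := by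
    intro x y hxy
    obtain ⟨⟨a, a'⟩, ha, z, hz, e⟩ := Submodule.mem_sup.1 hxy
    obtain ⟨l, rfl⟩ := Finsupp.mem_span_range_iff_exists_finsupp.1 hz
    by_cases hl : l.support.Nonempty
    swap
    · rw [Finset.not_nonempty_iff_eq_empty, Finsupp.support_eq_empty] at hl
      subst hl
      rw [Finsupp.sum_zero_index, add_zero] at e
      obtain ⟨rfl, rfl⟩ := Prod.mk.inj e
      exact ⟨hR.pos ha, fun h0 => hle (hR.psi ha h0)⟩
    -- The least new element `c_k` governs the new part: modulo elements of `ψ`-value above `d = s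
    -- c_k`, the sum is `Q d - q (d - c_k)`, where `Q` is the sum of the coefficients and `q ≠ 0`
    -- that of `c_k`.
    obtain ⟨k, hk, hkmin⟩ := Finset.exists_min_image l.support (fun c : C => (c.1 : M)) hl
    obtain ⟨d, hd⟩ : ∃ d : M.Psi, (d : M) = AsympCouple.succ M.ψ k.1 :=
      ⟨⟨_, M.isModel.succ_mem _⟩, rfl⟩
    have hd' := psiMap_succ hh hd
    have hmin : ∀ i ∈ l.support, i ≠ k → (k.1 : M) < i.1 := fun i hi hik =>
      lt_of_le_of_ne (hkmin i hi) fun e => hik (Subtype.ext (Subtype.ext e.symm))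
    have hS := sum_sub_mem_small M.isModel l.support l (fun c : C => (c.1 : M))
      (fun c => c.1.2) hk hmin
    have hS' := sum_sub_mem_small N.isModel l.support l (fun c : C => (h c.1 : N))
      (fun c => (h c.1).2) hk fun i hi hik => (psiMap_lt hh).1 (hmin i hi hik)
    obtain ⟨ex, ey⟩ : x = a + ∑ c ∈ l.support, l c • (c.1 : M) ∧
        y = a' + ∑ c ∈ l.support, l c • (h c.1 : N) := by
      rw [Finsupp.sum] at e
      have e1 := congrArg Prod.fst e
      have e2 := congrArg Prod.snd e
      simp only [Prod.fst_add, Prod.snd_add, Prod.fst_sum, Prod.snd_sum, Prod.smul_fst,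
        Prod.smul_snd] at e1 e2
      exact ⟨e1.symm, e2.symm⟩
    rw [← hd] at hS
    rw [← hd'] at hS'
    generalize ∑ c ∈ l.support, l c • (c.1 : M) = s at *
    generalize ∑ c ∈ l.support, l c • (h c.1 : N) = s' at *
    generalize ∑ c ∈ l.support, l c = Q at *
    have hq : l k ≠ 0 := Finsupp.mem_support_iff.1 hk
    generalize l k = q at *
    have hkd : (k.1 : M) < d := by rw [hd]; exact M.isModel.lt_succ k.1.2
    have hkd' : (h k.1 : N) < h d := (psiMap_lt hh).1 hkd
    have hψ : M.ψ (-(q • ((d : M) - k.1))) = d := by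
      have h1 := sub_ne_zero.2 hkd.ne'
      rw [M.isModel.psi_neg (smul_ne_zero hq h1), M.isModel.psi_smul hq h1,
        M.isModel.psi_sub_of_lt k.1.2 d.2 hkd, hd]
    have hψ' : N.ψ (-(q • ((h d : N) - h k.1))) = h d := by
      have h1 := sub_ne_zero.2 hkd'.ne'
      rw [N.isModel.psi_neg (smul_ne_zero hq h1), N.isModel.psi_smul hq h1,
        N.isModel.psi_sub_of_lt (h k.1).2 (h d).2 hkd', hd']
    -- Either `a + Q d` is negligible and `-q (d - c_k)` leads, with `ψ`-value `d`; or an element of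
    -- the old domain with `ψ`-value below `d` leads.
    rcases leading_cases hR hh hRh ha k.2 hd Q with ⟨h1, h2⟩ | ⟨e, e', he, h0, h1, h2, h3, h4⟩
    · have hsign : 0 < -(q • ((d : M) - k.1)) ↔ 0 < -(q • ((h d : N) - h k.1)) := by
        rcases lt_or_gt_of_ne hq with hq | hq
        · rw [← neg_smul, ← neg_smul]
          exact iff_of_true (rat_smul_pos (neg_pos.2 hq) (sub_pos.2 hkd))
            (rat_smul_pos (neg_pos.2 hq) (sub_pos.2 hkd'))
        · rw [neg_pos, neg_pos]
          exact iff_of_false (rat_smul_pos hq (sub_pos.2 hkd)).not_gt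
            (rat_smul_pos hq (sub_pos.2 hkd')).not_gt
      obtain ⟨r1, r2, r3⟩ := decomposition (x := x) (y := y)
        (neg_ne_zero.2 (smul_ne_zero hq (sub_ne_zero.2 hkd.ne')))
        (neg_ne_zero.2 (smul_ne_zero hq (sub_ne_zero.2 hkd'.ne'))) hsign
        (by
          rw [hψ, ex]
          have := Submodule.add_mem _ h1 hS
          convert this using 1
          abel)
        (by
          rw [hψ', ey]
          have := Submodule.add_mem _ h2 hS'
          convert this using 1
          abel)
      refine ⟨r1, fun _ => ?_⟩
      rw [r2, r3, hψ, hψ']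
      exact hgraph d
    · obtain ⟨r1, r2, r3⟩ := decomposition (x := x) (y := y) h0
        (fun h' => h0 ((rel_eq_zero_iff hR.pos he).2 h')) (hR.pos he)
        (by
          rw [ex]
          have := Submodule.add_mem _ (Submodule.add_mem _ h3
            (M.isModel.small_mono h1.le hS)) (M.isModel.mem_small_of_lt (hψ.symm ▸ h1))
          convert this using 1
          abel)
        (by
          rw [ey]
          have := Submodule.add_mem _ (Submodule.add_mem _ h4
            (N.isModel.small_mono h2.le hS')) (N.isModel.mem_small_of_lt (hψ'.symm ▸ h2))
          convert this using 1
          abel)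
      refine ⟨r1, fun _ => ?_⟩
      rw [r2, r3]
      exact hle (hR.psi he h0)
  exact ⟨R', hle, fun h => (key h).1, fun h => (key h).2, hh, hgraph⟩

end AdjoinPsi

/-! ### Adjoining an arbitrary element over `Ψ` -/

section AdjoinElement

/-- Adjoining one element to a partial isomorphism defined on all of `Ψ`. -/
theorem IsFull.adjoin {R : Submodule ℚ (M × N)} {h : M.Psi → N.Psi} (hR : IsFull R h) {b : M}
    {b' : N} (hb : ∀ {x y}, (x, y) ∈ R → x ≠ b ∧ y ≠ b' ∧ (x < b ↔ y < b') ∧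
      (M.ψ (b - x), N.ψ (b' - y)) ∈ R) :
    IsFull (R ⊔ Submodule.span ℚ {(b, b')}) h := by
  have key : ∀ {x y}, (x, y) ∈ R ⊔ Submodule.span ℚ {(b, b')} →
      (0 < x ↔ 0 < y) ∧ (x ≠ 0 → (M.ψ x, N.ψ y) ∈ R) := by
    intro x y hxy
    obtain ⟨⟨a, a'⟩, ha, z, hz, e⟩ := Submodule.mem_sup.1 hxy
    obtain ⟨q, rfl⟩ := Submodule.mem_span_singleton.1 hz
    obtain ⟨ex, ey⟩ := Prod.mk.inj e
    have ex : x = a + q • b := ex.symm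
    have ey : y = a' + q • b' := ey.symm
    by_cases hq : q = 0
    · rw [hq, zero_smul, add_zero] at ex ey
      rw [ex, ey]
      exact ⟨hR.pos ha, hR.psi ha⟩
    -- Up to a nonzero rational factor, every new element is a difference between `b` and an element
    -- of the domain. Its `ψ`-value is therefore already in the domain.
    have hx : x = q • (b - (-q⁻¹) • a) := by
      rw [ex, smul_sub, smul_smul, mul_neg, mul_inv_cancel₀ hq, neg_one_smul, sub_neg_eq_add,
        add_comm]
    have hy : y = q • (b' - (-q⁻¹) • a') := by
      rw [ey, smul_sub, smul_smul, mul_neg, mul_inv_cancel₀ hq, neg_one_smul, sub_neg_eq_add,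
        add_comm]
    obtain ⟨h1, h2, h3, h4⟩ := hb (R.smul_mem (-q⁻¹) ha)
    simp only at h1 h2 h3 h4
    generalize (-q⁻¹) • a = α at *
    generalize (-q⁻¹) • a' = α' at *
    rw [hx, hy, M.isModel.psi_smul hq (sub_ne_zero.2 h1.symm),
      N.isModel.psi_smul hq (sub_ne_zero.2 h2.symm)]
    refine ⟨?_, fun _ => h4⟩
    rcases lt_or_gt_of_ne hq with hq | hq
    · have e1 : q • (b - α) = (-q) • (α - b) := by module
      have e2 : q • (b' - α') = (-q) • (α' - b') := by module
      rw [e1, e2, rat_smul_pos_iff (neg_pos.2 hq), rat_smul_pos_iff (neg_pos.2 hq), sub_pos,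
        sub_pos, ← not_iff_not, not_lt, not_lt, h1.le_iff_lt, h2.le_iff_lt]
      exact h3
    · rw [rat_smul_pos_iff hq, rat_smul_pos_iff hq, sub_pos, sub_pos]
      exact h3
  exact ⟨fun h => (key h).1, fun h h0 => (le_sup_left : R ≤ _) ((key h).2 h0), hR.elem,
    fun c => (le_sup_left : R ≤ _) (hR.graph c)⟩

theorem IsFull.forth {R : Submodule ℚ (M × N)} {h : M.Psi → N.Psi} (hR : IsFull R h) (b : M) :
    ∃ (N' : TlogModel.{u}) (j : N →ₗ[ℚ] N') (R' : Submodule ℚ (M × N')),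
      IsElem j ∧ BackForth R' ∧ (∀ {x y}, (x, y) ∈ R → (x, j y) ∈ R') ∧ ∃ b', (b, b') ∈ R' := by
  classical
  by_cases hb : ∃ y, (b, y) ∈ R
  · obtain ⟨y, hy⟩ := hb
    -- Nothing needs to be adjoined here; an ultrapower over a one-point index set serves as the
    -- extension.
    have hj := isElem_const (N := N) (pure PUnit.unit : Ultrafilter PUnit.{u + 1})
    exact ⟨_, _, TlogModel.push R _, hj, hR.backForth.push hj, mem_push_of_mem _, _,
      mem_push_of_mem _ hy⟩
  -- The index set is `N` itself: each finite set of conditions on the image of `b` is satisfied by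
  -- some element of `N`, and the class of the identity function satisfies all of them.
  let s : Finset R → Set N := fun F => {x | ∀ r ∈ F, r.1.2 ≠ x ∧ (r.1.1 < b ↔ r.1.2 < x) ∧
    (M.ψ (b - r.1.1), N.ψ (x - r.1.2)) ∈ R}
  obtain ⟨U, hU⟩ := exists_ultrafilter_of_directed s
    (fun F G => ⟨F ∪ G, fun x hx r hr => hx r (Finset.mem_union_left _ hr),
      fun x hx r hr => hx r (Finset.mem_union_right _ hr)⟩)
    (by
      intro F
      obtain ⟨x, hx, H⟩ := exists_mem_of_finset M.isModel (A := R.map (LinearMap.fst ℚ M N))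
        (fun c hc => ⟨_, hR.graph ⟨c, hc⟩, rfl⟩)
        (b := b) (by rintro ⟨r, hr, rfl⟩; exact hb ⟨r.2, hr⟩) (F.image fun r => r.1.1)
        (fun a ha => by
          obtain ⟨r, -, rfl⟩ := Finset.mem_image.1 ha
          exact ⟨_, r.2, rfl⟩)
      obtain ⟨⟨x, y⟩, hxy, rfl⟩ := hx
      refine ⟨y, fun r hr => ?_⟩
      obtain ⟨h1, h2, h3⟩ := H _ (Finset.mem_image_of_mem _ hr)
      have h1 : x ≠ r.1.1 := h1
      have h2 : r.1.1 < x ↔ r.1.1 < b := h2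
      have h3 : M.ψ (x - r.1.1) = M.ψ (b - r.1.1) := h3
      refine ⟨fun e => h1 ((rel_eq_iff hR.pos hxy r.2).2 e.symm), ?_, ?_⟩
      · rw [← h2]
        exact rel_lt_iff hR.pos r.2 hxy
      · rw [← h3]
        exact hR.psi (R.sub_mem hxy r.2) (sub_ne_zero.2 h1))
  have hj := isElem_const (N := N) U
  let b' : N.ultra U := ((fun x => x : N → N) : Filter.Germ (U : Filter N) N)
  have hR' := (hR.push hj).adjoin (b := b) (b' := b') (by
    intro x y hxy
    obtain ⟨z, hz, rfl⟩ := mem_push.1 hxy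
    have hm := hU {⟨(x, z), hz⟩}
    have hm : ∀ᶠ w in (U : Filter N), z ≠ w ∧ (x < b ↔ z < w) ∧ (M.ψ (b - x), N.ψ (w - z)) ∈ R := by
      filter_upwards [hm] with w hw using hw _ (Finset.mem_singleton_self _)
    have hψΨ : M.ψ (b - x) ∈ M.Psi :=
      M.isModel.psi_mem (sub_ne_zero.2 fun e => hb ⟨z, e ▸ hz⟩)
    refine ⟨fun e => hb ⟨z, e ▸ hz⟩, fun e => ?_, ?_, ?_⟩
    · obtain ⟨w, hw, hw'⟩ := ((germ_eq_iff (U := U) (x := fun _ => z) (y := fun w => w)).1 e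
        |>.and hm).exists
      exact hw'.1 hw
    · refine Iff.trans ?_ (Filter.Germ.coe_lt (φ := U) (f := fun _ => z) (g := fun w => w)).symm
      rw [Filter.eventually_congr (hm.mono fun w hw => hw.2.1.symm)]
      simp
    -- Here fullness is used: `ψ (b - x)` has a prescribed image under `h`, so `ψ (w - z)` is the
    -- same element of `N` for almost all `w` and its class is constant.
    · have e : (N.ultra U).ψ (b' - const N U z) = const N U (h ⟨_, hψΨ⟩) := by
        refine (germ_eq_iff (U := U) (x := fun w => N.ψ (w - z))).2 ?_
        filter_upwards [hm] with w hw
        exact (rel_eq_iff hR.pos hw.2.2 (hR.graph ⟨_, hψΨ⟩)).1 rfl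
      rw [e]
      exact mem_push_of_mem _ (hR.graph ⟨_, hψΨ⟩))
  refine ⟨_, _, _, hj, hR'.backForth, fun hxy => (le_sup_left : TlogModel.push R _ ≤ _)
    (mem_push_of_mem _ hxy), b', ?_⟩
  exact (le_sup_right : Submodule.span ℚ {(b, b')} ≤ _) (Submodule.mem_span_singleton_self _)

end AdjoinElement

end TlogModel

/-! ### Back and forth -/

namespace TlogModel

variable {M N N' : TlogModel.{u}}

/-- The relation `T` can prescribe images for elements of `Ψ` outside the domain of `R`. This
freedom is used in the final argument, where `T` matches the generic tuples. -/
theorem BackForth.psi_extension {R : Submodule ℚ (M × N)} (hR : BackForth R)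
    {T : M.Psi → N.Psi → Prop}
    (hT : ∀ {α : Type u} (φ : ltLang.Formula α) (v : α → M.Psi) (w : α → N.Psi),
      (∀ a, T (v a) (w a)) → (φ.Realize v ↔ φ.Realize w))
    (hRT : ∀ (c : M.Psi) (d : N.Psi), ((c : M), (d : N)) ∈ R → T c d) :
    ∃ (N' : TlogModel.{u}) (j : N →ₗ[ℚ] N') (R' : Submodule ℚ (M × N')) (h : M.Psi → N'.Psi),
      IsElem j ∧ IsFull R' h ∧ (∀ {x y}, (x, y) ∈ R → (x, j y) ∈ R') ∧
        ∀ c d, T c d → ((c : M), j d) ∈ R' := by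
  obtain ⟨I, U, h, hh, hTh⟩ := exists_psi_extension hT
  have hj := isElem_const (N := N) U
  obtain ⟨R', hle, hR'⟩ := exists_isFull (hR.push hj) hh (by
    intro c d hcd
    obtain ⟨z, hz, rfl⟩ := mem_push.1 hcd
    exact (hTh c ⟨z, (hR.mem hz).1 c.2⟩ (hRT _ _ hz)).symm)
  refine ⟨_, _, R', h, hj, hR', fun hxy => hle (mem_push_of_mem _ hxy), fun c d hcd => ?_⟩
  rw [← hTh c d hcd]
  exact hR'.graph c

theorem BackForth.forth {R : Submodule ℚ (M × N)} (hR : BackForth R) (b : M) :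
    ∃ (N' : TlogModel.{u}) (j : N →ₗ[ℚ] N') (R' : Submodule ℚ (M × N')),
      IsElem j ∧ BackForth R' ∧ (∀ {x y}, (x, y) ∈ R → (x, j y) ∈ R') ∧ ∃ b', (b, b') ∈ R' := by
  obtain ⟨N₁, j₁, R₁, h₁, hj₁, hR₁, hle₁, -⟩ :=
    hR.psi_extension (T := fun c d => ((c : M), (d : N)) ∈ R) hR.elem fun _ _ h => h
  obtain ⟨N₂, j₂, R₂, hj₂, hR₂, hle₂, hb⟩ := hR₁.forth b
  exact ⟨N₂, j₂ ∘ₗ j₁, R₂, hj₂.comp hj₁, hR₂, fun hxy => hle₂ (hle₁ hxy), hb⟩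

/-- The inverse relation. -/
def swap (R : Submodule ℚ (M × N)) : Submodule ℚ (N × M) :=
  R.comap (LinearMap.prod (LinearMap.snd ℚ N M) (LinearMap.fst ℚ N M))

theorem mem_swap {R : Submodule ℚ (M × N)} {x : M} {y : N} : (y, x) ∈ swap R ↔ (x, y) ∈ R :=
  Iff.rfl

/-- `BackForth` is symmetric, whereas `IsFull` is not, since the map on `Ψ` need not be onto. This
is why the weaker notion carries the induction. -/
theorem BackForth.swap {R : Submodule ℚ (M × N)} (hR : BackForth R) : BackForth (swap R) where
  pos h := (hR.pos (mem_swap.1 h)).symm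
  psi h h0 := hR.psi (mem_swap.1 h) fun h1 => h0 ((rel_eq_zero_iff hR.pos (mem_swap.1 h)).1 h1)
  succ h := hR.succ (mem_swap.1 h)
  mem h := (hR.mem (mem_swap.1 h)).symm
  pred hc hd h := hR.pred hd hc (mem_swap.1 h)
  elem φ v w h := (hR.elem φ w v fun a => mem_swap.1 (h a)).symm

theorem InfRel.swap {R : Submodule ℚ (M × N)} {a : GammaInf M.ψ} {b : GammaInf N.ψ}
    (h : InfRel R a b) : InfRel (swap R) b a := by
  rcases h with ⟨h1, h2⟩ | ⟨x, y, h, h1, h2⟩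
  · exact Or.inl ⟨h2, h1⟩
  · exact Or.inr ⟨y, x, h, h2, h1⟩

section Atomic

variable {R : Submodule ℚ (M × N)} (hR : BackForth R)

include hR

theorem infRel_eq_iff {a a' : GammaInf M.ψ} {b b' : GammaInf N.ψ} (h : InfRel R a b)
    (h' : InfRel R a' b') : a = a' ↔ b = b' := by
  rcases h with ⟨rfl, rfl⟩ | ⟨x, y, h, rfl, rfl⟩ <;>
    rcases h' with ⟨rfl, rfl⟩ | ⟨x', y', h', rfl, rfl⟩
  · exact iff_of_true rfl rfl
  · exact iff_of_false (toInf_ne_top _).symm (toInf_ne_top _).symm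
  · exact iff_of_false (toInf_ne_top _) (toInf_ne_top _)
  · rw [toInf_inj, toInf_inj]
    exact rel_eq_iff hR.pos h h'

theorem infRel_lt_iff {a a' : GammaInf M.ψ} {b b' : GammaInf N.ψ} (h : InfRel R a b)
    (h' : InfRel R a' b') : a < a' ↔ b < b' := by
  rcases h with ⟨rfl, rfl⟩ | ⟨x, y, h, rfl, rfl⟩
  · exact iff_of_false (not_top_lt_inf _) (not_top_lt_inf _)
  rcases h' with ⟨rfl, rfl⟩ | ⟨x', y', h', rfl, rfl⟩
  · exact iff_of_true (toInf_lt_top _) (toInf_lt_top _)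
  · rw [toInf_lt_toInf, toInf_lt_toInf]
    exact rel_lt_iff hR.pos h h'

omit hR in
theorem infRel_toInf {x : M} {y : N} (h : (x, y) ∈ R) : InfRel R (toInf M.ψ x) (toInf N.ψ y) :=
  Or.inr ⟨x, y, h, rfl, rfl⟩

theorem infRel_unaryVal (f : TlogFunc 1) {x : M} {y : N} (h : (x, y) ∈ R) :
    InfRel R (unaryVal M.ψ f x) (unaryVal N.ψ f y) := by
  cases f with
  | neg => exact infRel_toInf (R.neg_mem h)
  | psi =>
    by_cases h0 : x = 0
    · rw [unaryVal, unaryVal, if_pos h0, if_pos ((rel_eq_zero_iff hR.pos h).1 h0)]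
      exact Or.inl ⟨rfl, rfl⟩
    · rw [unaryVal, unaryVal, if_neg h0, if_neg fun h1 => h0 ((rel_eq_zero_iff hR.pos h).2 h1)]
      exact infRel_toInf (hR.psi h h0)
  | s => exact infRel_toInf (hR.succ h)
  | p =>
    by_cases hx : ∃ c ∈ M.Psi, succ M.ψ c = x
    · obtain ⟨c, hc, rfl⟩ := hx
      have hy : y ∈ N.Psi := (hR.mem h).1 (M.isModel.succ_mem c)
      have hy0 : y ≠ succ N.ψ 0 := by
        rintro rfl
        exact (M.isModel.succ_zero_lt_succ hc).ne'
          ((rel_eq_iff hR.pos h (hR.succ R.zero_mem)).2 rfl)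
      obtain ⟨d, hd, rfl⟩ := N.isModel.exists_pred hy hy0
      have h1 : unaryVal M.ψ .p (succ M.ψ c) = toInf M.ψ c := M.isModel.pred_succ hc
      have h2 : unaryVal N.ψ .p (succ N.ψ d) = toInf N.ψ d := N.isModel.pred_succ hd
      rw [h1, h2]
      exact infRel_toInf (hR.pred hc hd h)
    · refine Or.inl ⟨M.isModel.pred_eq_top hx, N.isModel.pred_eq_top ?_⟩
      rintro ⟨d, hd, rfl⟩
      have hxΨ : x ∈ M.Psi := (hR.mem h).2 (N.isModel.succ_mem d)
      have hx0 : x ≠ succ M.ψ 0 := by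
        rintro rfl
        exact (N.isModel.succ_zero_lt_succ hd).ne'
          ((rel_eq_iff hR.pos h (hR.succ R.zero_mem)).1 rfl)
      exact hx (M.isModel.exists_pred hxΨ hx0)
  | delta n =>
    rw [unaryVal, unaryVal, M.isModel.divBy_eq, N.isModel.divBy_eq]
    exact infRel_toInf (R.smul_mem _ h)

theorem infRel_funMap {n : ℕ} (f : TlogFunc n) {x : Fin n → GammaInf M.ψ}
    {y : Fin n → GammaInf N.ψ} (h : ∀ k, InfRel R (x k) (y k)) :
    InfRel R (Language.Structure.funMap (L := tlogLang) f x)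
      (Language.Structure.funMap (L := tlogLang) f y) := by
  have unary : ∀ (f : TlogFunc 1) {x : Fin 1 → GammaInf M.ψ} {y : Fin 1 → GammaInf N.ψ},
      (∀ k, InfRel R (x k) (y k)) →
      InfRel R (Language.Structure.funMap (L := tlogLang) f x)
        (Language.Structure.funMap (L := tlogLang) f y) := by
    intro f x y h
    have e1 : x = fun _ => x 0 := funext fun k => by rw [Subsingleton.elim k 0]
    have e2 : y = fun _ => y 0 := funext fun k => by rw [Subsingleton.elim k 0]
    rw [e1, e2]
    rcases h 0 with ⟨h1, h2⟩ | ⟨x', y', h', h1, h2⟩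
    · rw [h1, h2, funMap_unary_top, funMap_unary_top]
      exact Or.inl ⟨rfl, rfl⟩
    · rw [h1, h2, funMap_unary_toInf, funMap_unary_toInf]
      exact infRel_unaryVal hR f h'
  cases f with
  | zero => exact infRel_toInf R.zero_mem
  | infty => exact Or.inl ⟨rfl, rfl⟩
  | add =>
    have e1 : x = ![x 0, x 1] := funext fun k => by fin_cases k <;> rfl
    have e2 : y = ![y 0, y 1] := funext fun k => by fin_cases k <;> rfl
    rw [e1, e2]
    rcases h 0 with ⟨h1, h2⟩ | ⟨x', y', h', h1, h2⟩
    · rw [h1, h2, funMap_add_top_left, funMap_add_top_left]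
      exact Or.inl ⟨rfl, rfl⟩
    rcases h 1 with ⟨h3, h4⟩ | ⟨x'', y'', h'', h3, h4⟩
    · rw [h3, h4, funMap_add_top_right, funMap_add_top_right]
      exact Or.inl ⟨rfl, rfl⟩
    · rw [h1, h2, h3, h4, funMap_add_toInf, funMap_add_toInf]
      exact infRel_toInf (R.add_mem h' h'')
  | neg => exact unary .neg h
  | psi => exact unary .psi h
  | s => exact unary .s h
  | p => exact unary .p h
  | delta n => exact unary (.delta n) h

theorem infRel_term {α : Type*} (t : tlogLang.Term α) {v : α → GammaInf M.ψ}
    {w : α → GammaInf N.ψ} (h : ∀ a, InfRel R (v a) (w a)) :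
    InfRel R (t.realize v) (t.realize w) := by
  induction t with
  | var a => exact h a
  | func f ts ih => exact infRel_funMap hR f ih

end Atomic

/-- Atomic formulas are preserved because terms map related tuples to related values. The induction
ranges over all pairs of models because the quantifier step enlarges one of them. -/
theorem BackForth.elementary {R : Submodule ℚ (M × N)} (hR : BackForth R) : Elementary R := by
  intro α n φ
  have sum : ∀ {M N : TlogModel.{u}} {R : Submodule ℚ (M × N)} {n : ℕ} {v : α → GammaInf M.ψ}
      {w : α → GammaInf N.ψ} {xs : Fin n → GammaInf M.ψ} {ys : Fin n → GammaInf N.ψ},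
      (∀ a, InfRel R (v a) (w a)) → (∀ k, InfRel R (xs k) (ys k)) →
      ∀ a, InfRel R (Sum.elim v xs a) (Sum.elim w ys a) := by
    rintro M N R n v w xs ys h1 h2 (a | a)
    · exact h1 a
    · exact h2 a
  induction φ generalizing M N with
  | falsum => exact fun _ _ _ _ _ _ => Iff.rfl
  | equal t u =>
    intro v w xs ys h1 h2
    exact infRel_eq_iff hR (infRel_term hR t (sum h1 h2)) (infRel_term hR u (sum h1 h2))
  | rel r ts =>
    intro v w xs ys h1 h2
    cases r
    exact infRel_lt_iff hR (infRel_term hR (ts 0) (sum h1 h2)) (infRel_term hR (ts 1) (sum h1 h2))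
  | imp φ θ ih1 ih2 =>
    intro v w xs ys h1 h2
    exact imp_congr (ih1 hR v w xs ys h1 h2) (ih2 hR v w xs ys h1 h2)
  | all φ ih =>
    have snoc : ∀ {M N : TlogModel.{u}} {R : Submodule ℚ (M × N)} {n : ℕ}
        {xs : Fin n → GammaInf M.ψ} {ys : Fin n → GammaInf N.ψ} {a : GammaInf M.ψ}
        {b : GammaInf N.ψ}, (∀ k, InfRel R (xs k) (ys k)) → InfRel R a b →
        ∀ k, InfRel R ((Fin.snoc xs a : Fin (n + 1) → GammaInf M.ψ) k)
          ((Fin.snoc ys b : Fin (n + 1) → GammaInf N.ψ) k) := by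
      intro M N R n xs ys a b h1 h2 k
      refine Fin.lastCases ?_ (fun k => ?_) k
      · simpa using h2
      · simpa using h1 k
    have key : ∀ {M N : TlogModel.{u}} {R : Submodule ℚ (M × N)}, BackForth R →
        ∀ (v : α → GammaInf M.ψ) (w : α → GammaInf N.ψ) (xs : Fin _ → GammaInf M.ψ)
        (ys : Fin _ → GammaInf N.ψ), (∀ a, InfRel R (v a) (w a)) →
        (∀ k, InfRel R (xs k) (ys k)) →
        (φ.all.Realize w ys → φ.all.Realize v xs) := by
      intro M N R hR v w xs ys h1 h2 H a
      rcases eq_top_or_toInf a with rfl | ⟨x, rfl⟩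
      · exact (ih hR _ _ _ _ h1 (snoc h2 (Or.inl ⟨rfl, rfl⟩))).2 (H (topInf _))
      -- The image of `x` lives only in an elementary extension `N'` of `N`. The universal formula
      -- holds in `N'` because `j` is elementary; it is instantiated there and pulled back along
      -- `R'`.
      · obtain ⟨N', j, R', hj, hR', hle, b', hb'⟩ := hR.forth x
        have ext : ∀ {a b}, InfRel R a b → ∃ b', InfRel j.graph b b' ∧ InfRel R' a b' := by
          rintro a b (⟨rfl, rfl⟩ | ⟨x, y, h, rfl, rfl⟩)
          · exact ⟨topInf _, Or.inl ⟨rfl, rfl⟩, Or.inl ⟨rfl, rfl⟩⟩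
          · exact ⟨_, infRel_toInf ((LinearMap.mem_graph_iff _ _).2 rfl), infRel_toInf (hle h)⟩
        choose w' hw hw' using fun a => ext (h1 a)
        choose ys' hy hy' using fun k => ext (h2 k)
        exact (ih hR' _ _ _ _ hw' (snoc hy' (infRel_toInf hb'))).2
          ((hj.elem φ.all w w' ys ys' hw hy).1 H _)
    intro v w xs ys h1 h2
    exact ⟨key hR.swap w v ys xs (fun a => (h1 a).swap) fun k => (h2 k).swap,
      key hR v w xs ys h1 h2⟩

end TlogModel

/-- A divisible torsion-free abelian group is a vector space over `ℚ`. -/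
theorem nonempty_module_rat {Γ : Type*} [AddCommGroup Γ] [IsAddTorsionFree Γ]
    (h : ∀ n : ℕ, 1 ≤ n → ∀ α : Γ, ∃ β : Γ, n • β = α) : Nonempty (Module ℚ Γ) := by
  -- A divisible group coincides with its divisible hull, from which the scalar multiplication is
  -- transported.
  have hs : Function.Surjective (DivisibleHull.coeAddMonoidHom Γ) := by
    intro x
    induction x with | mk m s
    obtain ⟨β, hβ⟩ := h s s.pos m
    refine ⟨β, ?_⟩
    rw [DivisibleHull.coeAddMonoidHom_apply, DivisibleHull.mk_eq_mk_iff_smul_eq_smul]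
    simpa using hβ
  exact ⟨(AddEquiv.ofBijective (DivisibleHull.coeAddMonoidHom Γ)
    ⟨DivisibleHull.coe_injective, hs⟩).module ℚ⟩

/-- A set outside a family closed under finite unions and complements can be separated from its
complement by ultrafilters that agree on the family. -/
theorem exists_ultrafilter_pair {Y : Type*} {B : Set (Set Y)} (hempty : ∅ ∈ B)
    (hunion : ∀ s ∈ B, ∀ t ∈ B, s ∪ t ∈ B) (hcompl : ∀ s ∈ B, sᶜ ∈ B) {D : Set Y} (hD : D ∉ B) :
    ∃ U V : Ultrafilter Y, D ∈ U ∧ D ∉ V ∧ ∀ s ∈ B, s ∈ U ↔ s ∈ V := by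
  have : Nonempty {s // s ∈ B ∧ s ⊆ D} := ⟨⟨∅, hempty, Set.empty_subset D⟩⟩
  -- `U` contains `D` but no member of `B` included in `D`; the sets `D \ s` are nonempty since
  -- otherwise `D = s ∈ B`.
  obtain ⟨U, hU⟩ := exists_ultrafilter_of_directed (fun s : {s // s ∈ B ∧ s ⊆ D} => D \ s.1)
    (fun s t => ⟨⟨s.1 ∪ t.1, hunion _ s.2.1 _ t.2.1, Set.union_subset s.2.2 t.2.2⟩,
      Set.sdiff_subset_sdiff_right Set.subset_union_left,
      Set.sdiff_subset_sdiff_right Set.subset_union_right⟩)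
    (fun s => by
      by_contra hn
      rw [Set.not_nonempty_iff_eq_empty, Set.sdiff_eq_empty] at hn
      exact hD (Set.Subset.antisymm hn s.2.2 ▸ s.2.1))
  have hUD : D ∈ U := Filter.mem_of_superset (hU ⟨∅, hempty, Set.empty_subset D⟩) Set.sdiff_subset
  have hinter : ∀ s ∈ B, ∀ t ∈ B, s ∩ t ∈ B := by
    intro s hs t ht
    have := hcompl _ (hunion _ (hcompl s hs) _ (hcompl t ht))
    rwa [Set.compl_union, compl_compl, compl_compl] at this
  have huniv : Set.univ ∈ B := by simpa using hcompl _ hempty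
  have : Nonempty {s // s ∈ B ∧ s ∈ U} := ⟨⟨Set.univ, huniv, Filter.univ_mem⟩⟩
  -- `V` contains every member of `B` that lies in `U`, but avoids `D`. A member of `B` in `U` is
  -- never included in `D`, by the construction of `U`.
  obtain ⟨V, hV⟩ := exists_ultrafilter_of_directed (fun s : {s // s ∈ B ∧ s ∈ U} => s.1 \ D)
    (fun s t => ⟨⟨s.1 ∩ t.1, hinter _ s.2.1 _ t.2.1, Filter.inter_mem s.2.2 t.2.2⟩,
      Set.sdiff_subset_sdiff_left Set.inter_subset_left,
      Set.sdiff_subset_sdiff_left Set.inter_subset_right⟩)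
    (fun s => by
      by_contra hn
      rw [Set.not_nonempty_iff_eq_empty, Set.sdiff_eq_empty] at hn
      have h1 := Filter.inter_mem s.2.2 (hU ⟨s.1, s.2.1, hn⟩)
      rw [Set.inter_sdiff_self] at h1
      exact Ultrafilter.empty_notMem h1)
  have hUV : ∀ s ∈ B, s ∈ U → s ∈ V := fun s hs hsU =>
    Filter.mem_of_superset (hV ⟨s, hs, hsU⟩) Set.sdiff_subset
  refine ⟨U, V, hUD, fun hDV => ?_, fun s hs => ⟨hUV s hs, fun hsV => ?_⟩⟩
  · have h1 := Filter.inter_mem hDV (hV ⟨Set.univ, huniv, Filter.univ_mem⟩)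
    rw [Set.inter_sdiff_self] at h1
    exact Ultrafilter.empty_notMem h1
  · by_contra hsU
    exact Ultrafilter.compl_notMem_iff.2 hsV (hUV _ (hcompl s hs)
      (Ultrafilter.compl_mem_iff_notMem.2 hsU))

/-! ### Definable subsets of powers of `Ψ` are definable from the order -/

namespace TlogModel

variable (G : TlogModel.{u})

theorem isFull_diagonal : IsFull (M := G) (N := G) (LinearMap.id (R := ℚ) (M := G)).graph id where
  pos h := by
    have h := (LinearMap.mem_graph_iff _ _).1 h
    simp only [LinearMap.id_apply] at h
    rw [h]
  psi h _ := by
    have h := (LinearMap.mem_graph_iff _ _).1 h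
    simp only [LinearMap.id_apply] at h
    rw [h]
    exact (LinearMap.mem_graph_iff _ _).2 rfl
  elem _ := Iff.rfl
  graph _ := (LinearMap.mem_graph_iff _ _).2 rfl

/-- The diagonal relation between two ultrapowers of a model. -/
theorem exists_backForth_ultra {I : Type u} (U V : Ultrafilter I) :
    ∃ R : Submodule ℚ (G.ultra U × G.ultra V), BackForth R ∧
      ∀ {x y}, (x, y) ∈ R ↔ ∃ z, const G U z = x ∧ const G V z = y := by
  refine ⟨swap (push (swap (push (LinearMap.id (R := ℚ) (M := G)).graph (const G V))) (const G U)),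
    (((isFull_diagonal G).backForth.push (isElem_const V)).swap.push (isElem_const U)).swap,
    fun {x y} => ?_⟩
  rw [mem_swap, mem_push]
  constructor
  · rintro ⟨z, hz, rfl⟩
    obtain ⟨z', hz', rfl⟩ := mem_push.1 (mem_swap.1 hz)
    have h := (LinearMap.mem_graph_iff _ _).1 hz'
    simp only [LinearMap.id_apply] at h
    exact ⟨z, rfl, by rw [h]⟩
  · rintro ⟨z, rfl, rfl⟩
    exact ⟨z, mem_swap.2 (mem_push_of_mem _ ((LinearMap.mem_graph_iff _ _).2 rfl)), rfl⟩

theorem mem_psi_of_const {I : Type u} {U : Ultrafilter I} {z : G} {c : (G.ultra U).Psi}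
    (h : const G U z = c) : z ∈ G.Psi := (isElem_const U).mem z |>.1 (h ▸ c.2)

theorem definable_of_definable_image {n : ℕ} {D : Set (Fin n → G.Psi)}
    (hD : (Set.univ : Set (GammaInf G.ψ)).Definable tlogLang
      ((fun (y : Fin n → G.Psi) (i : Fin n) => toInf G.ψ (y i : G)) '' D)) :
    (Set.univ : Set G.Psi).Definable ltLang D := by
  by_contra hn
  obtain ⟨U, V, hU, hV, hUV⟩ := exists_ultrafilter_pair
    (B := {E : Set (Fin n → G.Psi) | (Set.univ : Set G.Psi).Definable ltLang E})
    Set.definable_empty (fun _ hs _ ht => hs.union ht) (fun _ hs => hs.compl) hn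
  obtain ⟨R, hR, hRmem⟩ := exists_backForth_ultra G U V
  -- Constants from `Ψ` and the `n` coordinate functions; the classes of the latter form the generic
  -- tuple in each ultrapower.
  let fam : G.Psi ⊕ Fin n → (Fin n → G.Psi) → G.Psi := Sum.elim (fun c _ => c) fun i y => y i
  obtain ⟨N', j, R', h', hj, hR', hle, hT'⟩ := hR.psi_extension
    (T := fun c d => ∃ k, c = psiGerm U (fam k) ∧ d = psiGerm V (fam k))
    (by
      intro α φ v w hvw
      choose k hk hk' using hvw
      obtain rfl : v = fun a => psiGerm U (fam (k a)) := funext hk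
      obtain rfl : w = fun a => psiGerm V (fam (k a)) := funext hk'
      rw [realize_psiGerm, realize_psiGerm]
      -- By Łoś, partial elementarity of `T` says exactly that `U` and `V` agree on a set defined by
      -- a `{<}`-formula with parameters from `Ψ`.
      refine hUV {y | φ.Realize fun a => fam (k a) y} ?_
      rw [Set.mem_ofPred_eq, Set.definable_iff_exists_formula_sum]
      refine ⟨φ.relabel fun a => Sum.map (fun c => ⟨c, trivial⟩) id (k a), ?_⟩
      ext y
      rw [Set.mem_ofPred_eq, Set.mem_ofPred_eq, Language.Formula.realize_relabel]
      refine iff_of_eq (congrArg _ (funext fun a => ?_))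
      rcases hka : k a with c | i <;> simp [fam, hka])
    (by
      rintro c d hcd
      obtain ⟨z, hz, hz'⟩ := hRmem.1 hcd
      exact ⟨Sum.inl ⟨z, mem_psi_of_const G hz⟩, Subtype.ext hz.symm, Subtype.ext hz'.symm⟩)
  rw [Set.definable_iff_exists_formula_sum] at hD
  obtain ⟨φ, hφ⟩ := hD
  let val : ((Set.univ : Set (GammaInf G.ψ)) ⊕ Fin n) → (Fin n → G.Psi) → GammaInf G.ψ :=
    Sum.elim (fun p _ => p) fun i y => toInf G.ψ (y i)
  have hval : ∀ y : Fin n → G.Psi, (φ.Realize fun a => val a y) ↔ y ∈ D := by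
    intro y
    have e : (fun a => val a y) =
        Sum.elim (fun p : (Set.univ : Set (GammaInf G.ψ)) => (p : GammaInf G.ψ)) fun i => toInf G.ψ (y i) := funext fun a => by cases a <;> rfl
    have h1 : φ.Realize (fun a => val a y) ↔
        (fun i => toInf G.ψ (y i : G)) ∈
          (fun (y : Fin n → G.Psi) (i : Fin n) => toInf G.ψ (y i : G)) '' D := by
      rw [hφ, e]
      rfl
    rw [h1]
    refine Function.Injective.mem_set_image fun y z hyz => ?_
    exact funext fun i => Subtype.ext (toInf_inj.1 (congrFun hyz i))
  -- The generic tuple of an ultrapower satisfies the definition of `D` exactly when `D` belongs to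
  -- the ultrafilter.
  have los : ∀ W : Ultrafilter (Fin n → G.Psi),
      φ.Realize (M := GammaInf (G.ultra W).ψ) (fun a => germInf W G.ψ (val a)) ↔ D ∈ W := by
    intro W
    refine (realize_boundedFormula_zero (M := GammaInf (G.ultra W).ψ) φ _
      fun k => germInf W G.ψ (k.elim0 : (Fin n → G.Psi) → GammaInf G.ψ)).symm.trans ?_
    refine (realize_boundedFormula_germInf G.isModel φ val fun k => k.elim0).trans ?_
    refine Filter.eventually_congr (Filter.Eventually.of_forall fun y => ?_)
    exact (realize_boundedFormula_zero _ _ _).trans (hval y)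
  have hrel : ∀ a, ∃ b, InfRel (M := G.ultra V) (N := N') j.graph (germInf V G.ψ (val a)) b ∧
      InfRel (M := G.ultra U) (N := N') R' (germInf U G.ψ (val a)) b := by
    rintro (⟨p, -⟩ | i)
    · rcases eq_top_or_toInf p with rfl | ⟨x, rfl⟩
      · exact ⟨topInf _,
          Or.inl ⟨germInf_of_top (Filter.Eventually.of_forall fun _ => rfl), rfl⟩,
          Or.inl ⟨germInf_of_top (Filter.Eventually.of_forall fun _ => rfl), rfl⟩⟩
      · exact ⟨toInf _ (j (const G V x)),
          Or.inr ⟨const G V x, _, (LinearMap.mem_graph_iff _ _).2 rfl,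
            germInf_of_toInf (Filter.Eventually.of_forall fun _ => rfl), rfl⟩,
          Or.inr ⟨const G U x, _, hle (hRmem.2 ⟨x, rfl, rfl⟩),
            germInf_of_toInf (Filter.Eventually.of_forall fun _ => rfl), rfl⟩⟩
    · exact ⟨toInf _ (j (psiGerm V fun y => y i)),
        Or.inr ⟨_, _, (LinearMap.mem_graph_iff _ _).2 rfl,
          germInf_of_toInf (Filter.Eventually.of_forall fun _ => rfl), rfl⟩,
        Or.inr ⟨_, _, hT' (psiGerm U fun y => y i) (psiGerm V fun y => y i) ⟨Sum.inr i, rfl, rfl⟩,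
          germInf_of_toInf (Filter.Eventually.of_forall fun _ => rfl), rfl⟩⟩
  choose b hb hb' using hrel
  have h1 := Elementary.realize_formula hj.elem φ hb
  have h2 := Elementary.realize_formula hR'.backForth.elementary φ hb'
  exact hV ((los V).1 (h1.2 (h2.1 ((los U).2 hU))))

end TlogModel

/-! ### From the order on `Ψ` back to `(Γ, ψ)` -/

section StablyEmbedded

variable {Γ : Type*} [AddCommGroup Γ] [LinearOrder Γ] [IsOrderedAddMonoid Γ] {ψ : Γ → Γ}

theorem definable_psiInf (h : IsModelTlog ψ) (A : Set (GammaInf ψ)) {α : Type*} (i : α) :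
    A.Definable tlogLang {x : α → GammaInf ψ | x i ∈ psiInf ψ} := by
  rw [Set.definable_iff_exists_formula_sum]
  refine ⟨isPsi (.var (Sum.inl (Sum.inr i))), ?_⟩
  ext x
  rw [Set.mem_ofPred_eq, Set.mem_ofPred_eq, Language.Formula.Realize, realize_isPsi h]
  rfl

/-- A set definable in `(Ψ; <)` is definable in `(Γ, ψ)` with parameters from `Ψ`. -/
theorem definable_image_of_definable (h : IsModelTlog ψ) {n : ℕ} {D : Set (Fin n → psiSet ψ)}
    (hD : (Set.univ : Set (psiSet ψ)).Definable ltLang D) :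
    (psiInf ψ).Definable tlogLang
      ((fun (y : Fin n → psiSet ψ) (i : Fin n) => toInf ψ (y i : Γ)) '' D) := by
  obtain ⟨φ, rfl⟩ := Set.definable_iff_exists_formula_sum.1 hD
  let θ : tlogLang.Formula (psiInf ψ ⊕ Fin n) := Language.Formula.relabel
    (Sum.map (fun c : (Set.univ : Set (psiSet ψ)) => ⟨toInf ψ c.1, ⟨_, c.1.2, rfl⟩⟩) id)
    (relForm φ : tlogLang.Formula _)
  have hθ : (psiInf ψ).Definable tlogLang
      {x : Fin n → GammaInf ψ | θ.Realize (Sum.elim (fun p : psiInf ψ => (p : GammaInf ψ)) x)} :=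
    Set.definable_iff_exists_formula_sum.2 ⟨θ, rfl⟩
  have key : ∀ y : Fin n → psiSet ψ,
      θ.Realize (Sum.elim (fun p : psiInf ψ => (p : GammaInf ψ)) fun i => toInf ψ (y i)) ↔
        φ.Realize (Sum.elim (fun c : (Set.univ : Set (psiSet ψ)) => (c : psiSet ψ)) y) := by
    intro y
    rw [← realize_formula_relForm h, Language.Formula.realize_relabel]
    refine iff_of_eq (congrArg _ (funext fun a => ?_))
    cases a <;> rfl
  have hΨ := Set.definable_iInter_of_finite fun i : Fin n => definable_psiInf h (psiInf ψ) i
  convert hθ.inter hΨ using 1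
  ext x
  simp only [Set.mem_image, Set.mem_ofPred_eq, Set.mem_inter_iff, Set.mem_iInter]
  constructor
  · rintro ⟨y, hy, rfl⟩
    exact ⟨(key y).2 hy, fun i => ⟨_, (y i).2, rfl⟩⟩
  · rintro ⟨hx, hxΨ⟩
    choose y hy hyx using hxΨ
    obtain rfl : (fun i => toInf ψ (y i)) = x := funext hyx
    exact ⟨fun i => ⟨y i, hy i⟩, (key fun i => ⟨y i, hy i⟩).1 hx, rfl⟩

end StablyEmbedded

end AsympCouple

end

theorem mainTheorem5 {Γ : Type*} [AddCommGroup Γ] [LinearOrder Γ] [IsOrderedAddMonoid Γ]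
    (ψ : Γ → Γ) (hψ : AsympCouple.IsModelTlog ψ) :
    AsympCouple.StablyEmbedded AsympCouple.tlogLang (AsympCouple.psiInf ψ) ∧
      ∀ (n : ℕ) (D : Set (Fin n → AsympCouple.psiSet ψ)),
        (Set.univ : Set (AsympCouple.GammaInf ψ)).Definable AsympCouple.tlogLang
          ((fun (y : Fin n → AsympCouple.psiSet ψ) (i : Fin n) =>
            AsympCouple.toInf ψ (y i : Γ)) '' D) →
        (Set.univ : Set (AsympCouple.psiSet ψ)).Definable AsympCouple.ltLang D := by
  -- Divisibility makes `Γ` a vector space over ℚ, so partial isomorphisms can be taken as linear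
  -- relations.
  obtain ⟨inst⟩ := AsympCouple.nonempty_module_rat hψ.divisible
  have main : ∀ (n : ℕ) (D : Set (Fin n → AsympCouple.psiSet ψ)),
      (Set.univ : Set (AsympCouple.GammaInf ψ)).Definable AsympCouple.tlogLang
        ((fun (y : Fin n → AsympCouple.psiSet ψ) (i : Fin n) =>
          AsympCouple.toInf ψ (y i : Γ)) '' D) →
      (Set.univ : Set (AsympCouple.psiSet ψ)).Definable AsympCouple.ltLang D :=
    fun n D hD => AsympCouple.TlogModel.definable_of_definable_image ⟨Γ, ψ, hψ⟩ hD
  refine ⟨⟨AsympCouple.definable_psiInf hψ ∅ 0, fun n D hDΨ hD => ?_⟩, main⟩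
  -- Since `D` consists of tuples from `Ψ`, it is the image of its trace. The trace is definable in
  -- `(Ψ; <)`, and relativization returns a definition with parameters from `Ψ` only.
  have e : (fun (y : Fin n → AsympCouple.psiSet ψ) (i : Fin n) =>
      AsympCouple.toInf ψ (y i : Γ)) '' {y | (fun i => AsympCouple.toInf ψ (y i : Γ)) ∈ D} = D := by
    ext x
    constructor
    · rintro ⟨y, hy, rfl⟩
      exact hy
    · intro hx
      choose y hy hyx using hDΨ x hx
      obtain rfl : (fun i => AsympCouple.toInf ψ (y i)) = x := funext hyx
      exact ⟨fun i => ⟨y i, hy i⟩, hx, rfl⟩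
  rw [← e] at hD ⊢
  exact AsympCouple.definable_image_of_definable hψ (main n _ hD)
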